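/- Let $0<\alpha<1$. For $f:\mathbb R^2\to\mathbb R$ put $$\|f\|_{\mathring C^{0,\alpha}}=\sup_x|f(x)|+\sup_{x\ne x'}\frac{\big||x|^\alpha f(x)-|x'|^\alpha f(x')\big|}{|x-x'|^\alpha},$$ and let $\mathring C^{0,\alpha}(\mathbb R^2)$ be the space of $f$ for which this is finite. Let $O_\theta$ be the counterclockwise rotation by the angle $\theta$ about the origin; $f$ is $m$-fold symmetric if $f(O_{2\pi/m}x)=f(x)$ for all $x$. No decay of $f$ at infinity is assumed. (1) There is a constant $C_\alpha$, depending only on $\alpha$, such that for all integers $m\ge3$ and all $m$-fold symmetric $f\in\mathring C^{0,\alpha}(\mathbb R^2)$ the following holds. There is exactly one continuous $m$-fold symmetric function $\psi=(-\Delta)^{-1}f$ on $\mathbb R^2$ with $|\psi(x)|\le C|x|^2$ for some constant $C$ and all $x$, and with $-\Delta\psi=f$ in the sense of distributions. Its second distributional derivatives are functions $\partial_i\partial_j\psi\in\mathring C^{0,\alpha}(\mathbb R^2)$ (each determined up to its value at the origin, which can be chosen so that the bound holds), and $\|\partial_i\partial_j\psi\|_{\mathring C^{0,\alpha}}\le C_\alpha\|f\|_{\mathring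 C^{0,\alpha}}$ for $i,j\in\{1,2\}$. (2) Let $P:\mathbb R^2\to\mathbb R$ be smooth away from the origin, homogeneous of degree $-2$, and of mean zero on circles around the origin. There is a constant $C$, depending only on $\alpha$ and $P$, such that the following holds for every integer $m\ge3$ for which the $m$-fold symmetrization of $P$ decays integrably, that is, for which there are constants $C',c'>0$ with $$\Big|\sum_{i=1}^mP(x-O_{2\pi/m}^i y)\Big|\le C'\frac{|x|}{|y|^3}\qquad\text{whenever } y\neq 0,\ |y|\ge c'|x|.$$ For every $m$-fold symmetric $g\in\mathring C^{0,\alpha}(\mathbb R^2)$ the principal value $$Tg(x)=\lim_{\varepsilon\to0^+,\,R\to\infty}\int_{|x-y|>\varepsilon,\ |y|\le R}P(x-y)g(y)\,dy$$ exists for every $x\in\mathbb R^2$, $Tg\in\mathring C^{0,\alpha}(\mathbb R^2)$, and $\|Tg\|_{\mathring C^{0,\alpha}}\le C\|g\|_{\mathring C^{0,\alpha}}$. -/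

import Mathlib

open Real Filter Topology MeasureTheory
open scoped ENNReal NNReal ContDiff Laplacian

/-- The Euclidean plane `ℝ²`. -/
abbrev Plane : Type := EuclideanSpace ℝ (Fin 2)

/-- The counterclockwise rotation of the plane about the origin by the angle `θ`. -/
noncomputable def rot (θ : ℝ) (x : Plane) : Plane :=
  !₂[cos θ * x 0 - sin θ * x 1, sin θ * x 0 + cos θ * x 1]

/-- `f` is `m`-fold rotationally symmetric around the origin. -/
def IsFoldSymmetric (m : ℕ) (f : Plane → ℝ) : Prop :=
  ∀ x, f (rot (2 * π / m) x) = f x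

/-- The norm of the critical space `C̊^{0,α}`: the supremum of `|f|` plus the homogeneous `α`-Hölder
seminorm of `|x|^α f(x)`; it is `∞` when `f` does not belong to the space. -/
noncomputable def ringNorm (α : ℝ) (f : Plane → ℝ) : ℝ≥0∞ :=
  (⨆ x, ‖f x‖ₑ) +
    ⨆ (x : Plane) (x' : Plane) (_ : x ≠ x'),
      ‖‖x‖ ^ α * f x - ‖x'‖ ^ α * f x'‖ₑ / ENNReal.ofReal (‖x - x'‖ ^ α)

/-- Membership in the space `C̊^{0,α}(ℝ²)`. -/
def MemRing (α : ℝ) (f : Plane → ℝ) : Prop :=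
  ringNorm α f < ⊤

/-- The `i`-th partial derivative of `φ`. -/
noncomputable def partialDeriv (i : Fin 2) (φ : Plane → ℝ) (x : Plane) : ℝ :=
  fderiv ℝ φ x (EuclideanSpace.single i 1)

/-- `-Δψ = f` in the sense of distributions on `ℝ²`. -/
def WeakNegLaplacianEq (ψ f : Plane → ℝ) : Prop :=
  ∀ φ : Plane → ℝ, ContDiff ℝ ∞ φ → HasCompactSupport φ →
    ∫ x, ψ x * (-(Δ φ) x) = ∫ x, f x * φ x

/-- `∂ᵢ∂ⱼψ = G` in the sense of distributions on `ℝ²`. -/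
def WeakSecondDerivEq (i j : Fin 2) (ψ G : Plane → ℝ) : Prop :=
  ∀ φ : Plane → ℝ, ContDiff ℝ ∞ φ → HasCompactSupport φ →
    ∫ x, ψ x * partialDeriv i (partialDeriv j φ) x = ∫ x, G x * φ x

/-- `ψ = (-Δ)⁻¹ f` in the class of `m`-fold symmetric functions: `ψ` is a continuous `m`-fold
symmetric function with `|ψ(x)| ≤ C |x|²` (in particular normalized by `ψ(0) = 0`) that solves
`-Δψ = f`. -/
structure IsInverseNegLaplacian (m : ℕ) (f ψ : Plane → ℝ) : Prop where
  continuous : Continuous ψ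
  symmetric : IsFoldSymmetric m ψ
  growth : ∃ C : ℝ, ∀ x, |ψ x| ≤ C * ‖x‖ ^ 2
  equation : WeakNegLaplacianEq ψ f

/-- A singular integral kernel on `ℝ²`: smooth away from the origin, homogeneous of degree `-2`,
and with mean zero on circles around the origin. -/
structure IsSingularKernel (P : Plane → ℝ) : Prop where
  smooth : ContDiffOn ℝ ∞ P {0}ᶜ
  homogeneous : ∀ (t : ℝ) (x : Plane), 0 < t → x ≠ 0 → P (t • x) = t⁻¹ ^ 2 * P x
  mean_zero : ∀ r : ℝ, 0 < r → ∫ θ in (0 : ℝ)..(2 * π), P !₂[r * cos θ, r * sin θ] = 0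

/-- The `m`-fold symmetrization of the kernel `P(x - y)` in `y` decays integrably at infinity:
`|∑ᵢ P(x - Oⁱ y)| ≤ C |x| / |y|³` for `|y| ≥ c |x|`, where `O` is the rotation by `2π/m`. -/
def HasIntegrableSymmetrization (m : ℕ) (P : Plane → ℝ) : Prop :=
  ∃ C c : ℝ, 0 < C ∧ 0 < c ∧ ∀ x y : Plane, y ≠ 0 → c * ‖x‖ ≤ ‖y‖ →
    |∑ i ∈ Finset.Icc 1 m, P (x - rot (2 * π * i / m) y)| ≤ C * ‖x‖ / ‖y‖ ^ 3

/-- The principal value integral `p.v. ∫ P(x - y) g(y) dy` exists and equals `L`: the integrals over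
`|x - y| > ε`, `|y| ≤ R` converge to `L` as `ε → 0⁺` and `R → ∞` (jointly). -/
def HasPrincipalValue (P g : Plane → ℝ) (x : Plane) (L : ℝ) : Prop :=
  Tendsto (fun p : ℝ × ℝ => ∫ y in {y : Plane | p.1 < ‖x - y‖ ∧ ‖y‖ ≤ p.2}, P (x - y) * g y)
    (𝓝[>] (0 : ℝ) ×ˢ atTop) (𝓝 L)

/-!
Both parts rest on one estimate, `exists_superposition_bound`. For every integer `k` let `K_k` be a
kernel at the scale `2^k` (`IsPiece`): of size `4^{-k}`, Lipschitz with constant of order `8^{-k}`,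
supported in `|z| ≤ 4 · 2^k`, and with vanishing sum over the rotations by the multiples of `2π/m`.
Then `f ↦ ∑ K_k * f` is bounded on the `m`-fold symmetric functions of the critical space, with a
bound depending only on `α` and the constants of the kernels, not on `m`. Indeed, with
`N = ‖f‖`,

* `K_k` has mean zero and `|x|^α |f(x) - f(y)| ≤ 2N |x - y|^α` for all `y`, so that
  `|K_k * f(x)| ≲ N (2^k / |x|)^α`;
* `K_k * f` vanishes at the origin by symmetry and has Lipschitz constant `≲ N 2^{-k}`, so that
  `|K_k * f(x)| ≲ N |x| / 2^k`;
* since `K_k` is Lipschitz and of mean zero, for `h = |x - x'| ≤ 2^k` and `|x| ≤ |x'|`,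
  `|x|^α |K_k * f(x) - K_k * f(x')| ≲ N h 2^{k(α-1)}`.

Summing geometric series over `k` gives the supremum bound and the Hölder bound.

For the singular integral, the decay condition at `x = 0` says that the symmetrization of `P`
vanishes; a radial dyadic partition of unity splits `P` into pieces, and the principal value is the
sum of the convolutions with the pieces by dominated convergence for series
(`hasPrincipalValue_tsum`). The mean value zero of the pieces also follows from the symmetrization.

For the Laplacian, the logarithm is decomposed into smooth radial annular pieces. The trace-free
part of the Hessian of a radial function has angular frequency two, so for `m ≥ 3` its
symmetrization vanishes and the basic estimate applies, while the traces telescope to an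
approximation of the Dirac mass (`partialDeriv_partialDeriv_potential`). The partial sums, corrected
by a multiple of `|x|²`, have a critical point with value zero at the origin, and their Hessians are
bounded and converge pointwise. Integrating twice along segments from the origin yields a potential
of quadratic growth, without any estimate of the logarithmic kernel itself.

Uniqueness is the Liouville theorem `eq_zero_of_harmonic`. By the telescoping of the traces a weakly
harmonic function equals its average against the approximate Dirac mass at every scale, so that its
Hessian is its convolution with trace-free kernels of arbitrarily large scale. These vanish at the
origin by symmetry and decay with the scale, because the function grows only quadratically.
-/

/-! ### Rotations of the plane -/

@[simp] lemma rot_apply_zero (θ : ℝ) (x : Plane) : rot θ x 0 = cos θ * x 0 - sin θ * x 1 := rfl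

@[simp] lemma rot_apply_one (θ : ℝ) (x : Plane) : rot θ x 1 = sin θ * x 0 + cos θ * x 1 := rfl

lemma plane_ext {x y : Plane} (h0 : x 0 = y 0) (h1 : x 1 = y 1) : x = y := by
  ext i; fin_cases i
  · exact h0
  · exact h1

lemma plane_norm_sq (x : Plane) : ‖x‖ ^ 2 = x 0 ^ 2 + x 1 ^ 2 := by
  rw [EuclideanSpace.norm_sq_eq]; simp

/-- Rotation by `θ` as a linear isometry of the plane. -/
noncomputable def rotIso (θ : ℝ) : Plane ≃ₗᵢ[ℝ] Plane where
  toFun := rot θ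
  invFun := rot (-θ)
  map_add' x y := by apply plane_ext <;> simp <;> ring
  map_smul' c x := by apply plane_ext <;> simp <;> ring
  left_inv x := by
    have h := sin_sq_add_cos_sq θ
    apply plane_ext <;> simp
    · linear_combination x 0 * h
    · linear_combination x 1 * h
  right_inv x := by
    have h := sin_sq_add_cos_sq θ
    apply plane_ext <;> simp
    · linear_combination x 0 * h
    · linear_combination x 1 * h
  norm_map' x := by
    have h := sin_sq_add_cos_sq θ
    rw [← sq_eq_sq₀ (norm_nonneg _) (norm_nonneg _), plane_norm_sq, plane_norm_sq]
    change rot θ x 0 ^ 2 + rot θ x 1 ^ 2 = _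
    simp only [rot_apply_zero, rot_apply_one]
    linear_combination (x 0 ^ 2 + x 1 ^ 2) * h

lemma coe_rotIso (θ : ℝ) : ⇑(rotIso θ) = rot θ := rfl

lemma norm_rot (θ : ℝ) (x : Plane) : ‖rot θ x‖ = ‖x‖ := (rotIso θ).norm_map x

lemma rot_smul (θ c : ℝ) (x : Plane) : rot θ (c • x) = c • rot θ x := (rotIso θ).map_smul c x

lemma rot_neg (θ : ℝ) (x : Plane) : rot θ (-x) = -rot θ x := (rotIso θ).map_neg x

lemma rot_sub (θ : ℝ) (x y : Plane) : rot θ (x - y) = rot θ x - rot θ y := (rotIso θ).map_sub x y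

lemma rot_add_angle (a b : ℝ) (x : Plane) : rot (a + b) x = rot a (rot b x) := by
  apply plane_ext <;> simp [cos_add, sin_add] <;> ring

lemma rot_zero_angle (x : Plane) : rot 0 x = x := by
  apply plane_ext <;> simp

lemma integral_comp_rot (θ : ℝ) (g : Plane → ℝ) : ∫ x, g (rot θ x) = ∫ x, g x :=
  (rotIso θ).measurePreserving.integral_comp
    (rotIso θ).toHomeomorph.measurableEmbedding g

lemma IsFoldSymmetric.rot_mul {m : ℕ} {f : Plane → ℝ} (hf : IsFoldSymmetric m f) (i : ℕ)
    (x : Plane) : f (rot (2 * π * i / m) x) = f x := by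
  induction i with
  | zero => simp [rot_zero_angle]
  | succ i ih =>
    have : 2 * π * ((i + 1 : ℕ) : ℝ) / m = 2 * π / m + 2 * π * i / m := by push_cast; ring
    rw [this, rot_add_angle, hf, ih]

/-- A kernel whose `m`-fold symmetrization vanishes annihilates `m`-fold symmetric functions. -/
lemma integral_mul_eq_zero_of_symmetrization {m : ℕ} (hm : 0 < m) {K f : Plane → ℝ}
    (hK : ∀ z, ∑ i ∈ Finset.Icc 1 m, K (rot (2 * π * i / m) z) = 0)
    (hf : IsFoldSymmetric m f) (hint : Integrable fun y => K y * f y) :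
    ∫ y, K y * f y = 0 := by
  have h1 : ∀ i : ℕ, ∫ y, K (rot (2 * π * i / m) y) * f y = ∫ y, K y * f y := fun i => by
    rw [← integral_comp_rot (2 * π * i / m) fun y => K y * f y]
    simp only [hf.rot_mul]
  have h2 : ∀ i : ℕ, Integrable fun y => K (rot (2 * π * i / m) y) * f y := fun i => by
    have := ((rotIso (2 * π * i / m)).measurePreserving.integrable_comp_emb
      (rotIso (2 * π * i / m)).toHomeomorph.measurableEmbedding).2 hint
    simpa only [Function.comp_def, coe_rotIso, hf.rot_mul] using! this
  have h3 : ∑ i ∈ Finset.Icc 1 m, ∫ y, K (rot (2 * π * i / m) y) * f y = 0 := by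
    rw [← integral_finsetSum _ fun i _ => h2 i]
    simp [← Finset.sum_mul, hK]
  simp only [h1, Finset.sum_const, Nat.card_Icc, nsmul_eq_mul] at h3
  have : ((m + 1 - 1 : ℕ) : ℝ) ≠ 0 := by simpa using hm.ne'
  exact (mul_eq_zero.1 h3).resolve_left this

lemma sum_exp_eq_zero {m j : ℕ} (hj : ¬ m ∣ j) (hm : m ≠ 0) :
    ∑ i ∈ Finset.Icc 1 m, Complex.exp ((j * (2 * π * i / m) : ℝ) * Complex.I) = 0 := by
  have hp := Complex.isPrimitiveRoot_exp m hm
  set ζ := Complex.exp (2 * π * Complex.I / m) with hζ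
  have h1 : ζ ^ j ≠ 1 := fun h => hj (hp.dvd_of_pow_eq_one j h)
  have h2 : ∀ i : ℕ, Complex.exp ((j * (2 * π * i / m) : ℝ) * Complex.I) = (ζ ^ j) ^ i :=
      fun i => by
    rw [← pow_mul, hζ, ← Complex.exp_nat_mul]
    congr 1; push_cast; ring
  simp only [h2]
  have h3 : ∑ i ∈ Finset.Icc 1 m, (ζ ^ j) ^ i = ∑ i ∈ Finset.range m, (ζ ^ j) ^ i * ζ ^ j := by
    have := Finset.sum_Ico_add' (fun i => (ζ ^ j) ^ i) 0 m 1
    rw [Finset.range_eq_Ico]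
    simp only [pow_succ] at this
    exact this.symm
  rw [h3, ← Finset.sum_mul, geom_sum_eq h1, ← pow_mul, mul_comm j m, pow_mul, hp.pow_eq_one]
  simp

lemma sum_cos_eq_zero {m j : ℕ} (hj : ¬ m ∣ j) (hm : m ≠ 0) :
    ∑ i ∈ Finset.Icc 1 m, cos (j * (2 * π * i / m)) = 0 := by
  have := congrArg Complex.re (sum_exp_eq_zero hj hm)
  rw [Complex.re_sum] at this
  simpa only [Complex.exp_ofReal_mul_I_re, Complex.zero_re] using this

lemma sum_sin_eq_zero {m j : ℕ} (hj : ¬ m ∣ j) (hm : m ≠ 0) :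
    ∑ i ∈ Finset.Icc 1 m, sin (j * (2 * π * i / m)) = 0 := by
  have := congrArg Complex.im (sum_exp_eq_zero hj hm)
  rw [Complex.im_sum] at this
  simpa only [Complex.exp_ofReal_mul_I_im, Complex.zero_im] using this

lemma not_dvd_of_three_le {m j : ℕ} (hm : 3 ≤ m) (hj0 : 0 < j) (hj : j ≤ 2) : ¬ m ∣ j :=
  fun h => by have := Nat.le_of_dvd hj0 h; omega

/-- The rotations of a vector by the multiples of `2π/m` sum to zero. -/
lemma sum_rot_apply_eq_zero {m : ℕ} (hm : 3 ≤ m) (z : Plane) (a : Fin 2) :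
    ∑ i ∈ Finset.Icc 1 m, rot (2 * π * i / m) z a = 0 := by
  have hc := sum_cos_eq_zero (not_dvd_of_three_le hm one_pos one_le_two) (by omega)
  have hs := sum_sin_eq_zero (not_dvd_of_three_le hm one_pos one_le_two) (by omega)
  simp only [Nat.cast_one, one_mul] at hc hs
  fin_cases a
  · simp [Finset.sum_sub_distrib, ← Finset.sum_mul, hc, hs]
  · simp [Finset.sum_add_distrib, ← Finset.sum_mul, hc, hs]

/-- The trace-free part of the quadratic form `z ⊗ z` has angular frequency two, so that its
symmetrization over the rotations by multiples of `2π/m` vanishes when `m ≥ 3`. -/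
lemma sum_rot_traceFree_eq_zero {m : ℕ} (hm : 3 ≤ m) (z : Plane) (a b : Fin 2) :
    ∑ i ∈ Finset.Icc 1 m, (rot (2 * π * i / m) z a * rot (2 * π * i / m) z b -
      (if a = b then 1 / 2 else 0) * ‖z‖ ^ 2) = 0 := by
  have hc := sum_cos_eq_zero (not_dvd_of_three_le hm two_pos le_rfl) (by omega)
  have hs := sum_sin_eq_zero (not_dvd_of_three_le hm two_pos le_rfl) (by omega)
  simp only [Nat.cast_ofNat, cos_two_mul, sin_two_mul] at hc hs
  have key : ∀ p q : ℝ, ∑ i ∈ Finset.Icc 1 m,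
      (p * (2 * cos (2 * π * i / m) ^ 2 - 1)
        + q * (2 * sin (2 * π * i / m) * cos (2 * π * i / m))) = 0 := fun p q => by
    rw [Finset.sum_add_distrib, ← Finset.mul_sum, ← Finset.mul_sum, hc, hs]; simp
  rw [plane_norm_sq]
  fin_cases a <;> fin_cases b
  · refine (Finset.sum_congr rfl fun i _ => ?_).trans
      (key ((z 0 ^ 2 - z 1 ^ 2) / 2) (-(z 0 * z 1)))
    simp
    linear_combination z 1 ^ 2 * sin_sq_add_cos_sq (2 * π * i / m)
  · refine (Finset.sum_congr rfl fun i _ => ?_).trans (key (z 0 * z 1) ((z 0 ^ 2 - z 1 ^ 2) / 2))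
    simp
    linear_combination - z 0 * z 1 * sin_sq_add_cos_sq (2 * π * i / m)
  · refine (Finset.sum_congr rfl fun i _ => ?_).trans (key (z 0 * z 1) ((z 0 ^ 2 - z 1 ^ 2) / 2))
    simp
    linear_combination - z 0 * z 1 * sin_sq_add_cos_sq (2 * π * i / m)
  · refine (Finset.sum_congr rfl fun i _ => ?_).trans (key (-(z 0 ^ 2 - z 1 ^ 2) / 2) (z 0 * z 1))
    simp
    linear_combination z 0 ^ 2 * sin_sq_add_cos_sq (2 * π * i / m)

/-! ### The critical space in terms of real bounds -/

/-- `N` bounds both the supremum of `|f|` and the `α`-Hölder seminorm of `|x|^α f(x)`. -/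
structure RingBound (α N : ℝ) (f : Plane → ℝ) : Prop where
  bound : ∀ x, |f x| ≤ N
  holder : ∀ x x', |‖x‖ ^ α * f x - ‖x'‖ ^ α * f x'| ≤ N * ‖x - x'‖ ^ α

lemma RingBound.nonneg {α N : ℝ} {f : Plane → ℝ} (hf : RingBound α N f) : 0 ≤ N :=
  (abs_nonneg _).trans (hf.bound 0)

lemma MemRing.ringBound {α : ℝ} {f : Plane → ℝ} (hf : MemRing α f) :
    RingBound α (ringNorm α f).toReal f := by
  have hfin : ringNorm α f ≠ ⊤ := hf.ne
  constructor
  · intro x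
    have h : ‖f x‖ₑ ≤ ringNorm α f :=
      (le_iSup (fun x => ‖f x‖ₑ) x).trans le_self_add
    have := ENNReal.toReal_mono hfin h
    simpa using this
  · intro x x'
    rcases eq_or_ne x x' with rfl | hx
    · simp; positivity
    have h : ‖‖x‖ ^ α * f x - ‖x'‖ ^ α * f x'‖ₑ / ENNReal.ofReal (‖x - x'‖ ^ α) ≤
        ringNorm α f := by
      refine le_trans ?_ le_add_self
      exact le_iSup_of_le x (le_iSup_of_le x' (le_iSup_of_le hx le_rfl))
    have hpos : 0 < ‖x - x'‖ ^ α := rpow_pos_of_pos (norm_pos_iff.2 (sub_ne_zero.2 hx)) _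
    have := ENNReal.toReal_mono hfin h
    rw [ENNReal.toReal_div, ENNReal.toReal_ofReal hpos.le, toReal_enorm, div_le_iff₀ hpos] at this
    exact this

lemma RingBound.ringNorm_le {α N : ℝ} {f : Plane → ℝ} (hf : RingBound α N f) :
    ringNorm α f ≤ ENNReal.ofReal (2 * N) := by
  rw [two_mul, ENNReal.ofReal_add hf.nonneg hf.nonneg]
  refine add_le_add (iSup_le fun x => ?_) (iSup_le fun x => iSup_le fun x' => iSup_le fun hx => ?_)
  · rw [Real.enorm_eq_ofReal_abs]
    exact ENNReal.ofReal_le_ofReal (hf.bound x)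
  · have hpos : 0 < ‖x - x'‖ ^ α := rpow_pos_of_pos (norm_pos_iff.2 (sub_ne_zero.2 hx)) _
    rw [Real.enorm_eq_ofReal_abs, ← ENNReal.ofReal_div_of_pos hpos]
    refine ENNReal.ofReal_le_ofReal ?_
    rw [div_le_iff₀ hpos]
    exact hf.holder x x'

/-- A real bound by a multiple of `‖f‖` yields the estimate for the extended norms. -/
lemma RingBound.memRing_and_le {α C : ℝ} {f g : Plane → ℝ} (hC : 0 ≤ C) (hf : MemRing α f)
    (hg : RingBound α (C * (ringNorm α f).toReal) g) :
    MemRing α g ∧ ringNorm α g ≤ ((2 * C).toNNReal : ℝ≥0) * ringNorm α f := by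
  have h := hg.ringNorm_le
  refine ⟨h.trans_lt ENNReal.ofReal_lt_top, h.trans_eq ?_⟩
  rw [← mul_assoc, ENNReal.ofReal_mul (by positivity), ENNReal.ofReal_toReal hf.ne]
  rfl

lemma RingBound.add {α N N' : ℝ} {f g : Plane → ℝ} (hf : RingBound α N f)
    (hg : RingBound α N' g) : RingBound α (N + N') fun x => f x + g x where
  bound x := (abs_add_le _ _).trans (add_le_add (hf.bound x) (hg.bound x))
  holder x x' := by
    have := (abs_add_le _ _).trans (add_le_add (hf.holder x x') (hg.holder x x'))
    rw [add_mul]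
    refine le_trans (le_of_eq ?_) this
    congr 1; ring

lemma RingBound.const_mul {α N : ℝ} {f : Plane → ℝ} (hf : RingBound α N f) (c : ℝ) :
    RingBound α (|c| * N) fun x => c * f x where
  bound x := by rw [abs_mul]; exact mul_le_mul_of_nonneg_left (hf.bound x) (abs_nonneg c)
  holder x x' := by
    have := mul_le_mul_of_nonneg_left (hf.holder x x') (abs_nonneg c)
    rw [mul_assoc]
    refine le_trans (le_of_eq ?_) this
    rw [← abs_mul]; congr 1; ring

lemma abs_rpow_sub_rpow_le {α a b : ℝ} (hα0 : 0 ≤ α) (hα1 : α ≤ 1) (ha : 0 ≤ a) (hb : 0 ≤ b) :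
    |a ^ α - b ^ α| ≤ |a - b| ^ α := by
  wlog h : b ≤ a generalizing a b
  · rw [abs_sub_comm, abs_sub_comm a]; exact this hb ha (le_of_not_ge h)
  rw [abs_of_nonneg (sub_nonneg.2 (rpow_le_rpow hb h hα0)), abs_of_nonneg (sub_nonneg.2 h)]
  have := rpow_add_le_add_rpow (sub_nonneg.2 h) hb hα0 hα1
  rw [sub_add_cancel] at this
  linarith

lemma abs_norm_rpow_sub_le {α : ℝ} (hα0 : 0 ≤ α) (hα1 : α ≤ 1) (x y : Plane) :
    |‖x‖ ^ α - ‖y‖ ^ α| ≤ ‖x - y‖ ^ α :=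
  (abs_rpow_sub_rpow_le hα0 hα1 (norm_nonneg x) (norm_nonneg y)).trans
    (rpow_le_rpow (abs_nonneg _) (abs_norm_sub_norm_le x y) hα0)

/-- Away from the origin the elements of the critical space are Hölder continuous, with a constant
that degenerates like `|x|^{-α}`. -/
lemma RingBound.abs_sub_le {α N : ℝ} {f : Plane → ℝ} (hf : RingBound α N f) (hα0 : 0 ≤ α)
    (hα1 : α ≤ 1) {x : Plane} (hx : x ≠ 0) (y : Plane) :
    |f y - f x| ≤ 2 * N * (‖x - y‖ / ‖x‖) ^ α := by
  have hpos : 0 < ‖x‖ ^ α := rpow_pos_of_pos (norm_pos_iff.2 hx) _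
  rw [div_rpow (norm_nonneg _) (norm_nonneg _), mul_div_assoc', le_div_iff₀ hpos]
  have h1 := hf.holder x y
  have h2 := mul_le_mul (abs_norm_rpow_sub_le hα0 hα1 x y) (hf.bound y) (abs_nonneg _)
    (by positivity)
  rw [← abs_mul] at h2
  calc |f y - f x| * ‖x‖ ^ α = |(‖x‖ ^ α - ‖y‖ ^ α) * f y - (‖x‖ ^ α * f x - ‖y‖ ^ α * f y)| := by
        rw [← abs_of_pos hpos, ← abs_mul, abs_of_pos hpos]; congr 1; ring
    _ ≤ _ := (abs_sub _ _).trans (add_le_add h2 h1)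
    _ = _ := by ring

lemma RingBound.aestronglyMeasurable {α N : ℝ} {f : Plane → ℝ} (hf : RingBound α N f)
    (hα : 0 < α) : AEStronglyMeasurable f volume := by
  have hc : Continuous fun x : Plane => ‖x‖ ^ α * f x := by
    have : HolderWith N.toNNReal α.toNNReal fun x : Plane => ‖x‖ ^ α * f x := by
      intro x y
      rw [edist_dist, edist_dist, Real.coe_toNNReal _ hα.le,
        ENNReal.ofReal_rpow_of_nonneg dist_nonneg hα.le]
      change _ ≤ ENNReal.ofReal N * _
      rw [← ENNReal.ofReal_mul hf.nonneg, Real.dist_eq, dist_eq_norm]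
      exact ENNReal.ofReal_le_ofReal (hf.holder x y)
    exact this.continuous (by simpa using hα)
  have hm : AEStronglyMeasurable (fun x : Plane => ‖x‖ ^ α * f x / ‖x‖ ^ α) volume := by
    refine (hc.measurable.div ?_).aestronglyMeasurable
    exact (continuous_norm.rpow_const fun _ => Or.inr hα.le).measurable
  refine hm.congr ?_
  have h0 : ∀ᵐ x : Plane, x ≠ 0 := by simp [ae_iff]
  filter_upwards [h0] with x hx
  have hpos : 0 < ‖x‖ ^ α := rpow_pos_of_pos (norm_pos_iff.2 hx) _
  field_simp

/-! ### Convolution with a kernel of one scale -/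

/-- The convolution `∫ K(x - y) f(y) dy`. -/
noncomputable def conv (K f : Plane → ℝ) (x : Plane) : ℝ := ∫ y, K (x - y) * f y

/-- A kernel living at the scale `s`, normalized like `s⁻² φ(z / s)`, whose `m`-fold symmetrization
vanishes. -/
structure IsPiece (m : ℕ) (A s : ℝ) (K : Plane → ℝ) : Prop where
  bound : ∀ z, |K z| ≤ A / s ^ 2
  lip : ∀ z z', |K z - K z'| ≤ A / s ^ 3 * ‖z - z'‖
  supp : ∀ z, 4 * s < ‖z‖ → K z = 0
  symm : ∀ z, ∑ i ∈ Finset.Icc 1 m, K (rot (2 * π * i / m) z) = 0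

lemma volume_real_closedBall_plane (x : Plane) {r : ℝ} (hr : 0 ≤ r) :
    volume.real (Metric.closedBall x r) = π * r ^ 2 := by
  rw [measureReal_def, EuclideanSpace.volume_closedBall_fin_two, ENNReal.toReal_mul,
    ENNReal.toReal_pow, ENNReal.toReal_ofReal hr, ENNReal.toReal_ofReal pi_pos.le]
  ring

lemma integrable_conv {K g : Plane → ℝ} {B M r : ℝ} {x : Plane} (hKm : Measurable K)
    (hK : ∀ z, |K z| ≤ B) (hs : ∀ z, r < ‖z‖ → K z = 0) (hgm : AEStronglyMeasurable g volume)
    (hg : ∀ y, ‖x - y‖ ≤ r → |g y| ≤ M) : Integrable fun y => K (x - y) * g y := by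
  have hsub : Function.support (fun y => K (x - y) * g y) ⊆ Metric.closedBall x r := by
    intro y hy
    by_contra h
    rw [Metric.mem_closedBall, dist_comm, dist_eq_norm, not_le] at h
    exact hy (by simp [hs _ h])
  rw [← integrableOn_iff_integrable_of_support_subset hsub]
  refine Measure.integrableOn_of_bounded (M := B * M) measure_closedBall_lt_top.ne
    ((hKm.comp (measurable_const.sub measurable_id)).aestronglyMeasurable.mul hgm) ?_
  filter_upwards [ae_restrict_mem measurableSet_closedBall] with y hy
  rw [Metric.mem_closedBall, dist_comm, dist_eq_norm] at hy
  rw [norm_mul]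
  exact mul_le_mul (hK _) (hg y hy) (norm_nonneg _) ((abs_nonneg _).trans (hK 0))

lemma abs_conv_le {K g : Plane → ℝ} {A M s : ℝ} {x : Plane} (hs0 : 0 < s)
    (hK : ∀ z, |K z| ≤ A / s ^ 2) (hs : ∀ z, 4 * s < ‖z‖ → K z = 0)
    (hg : ∀ y, ‖x - y‖ ≤ 4 * s → |g y| ≤ M) : |conv K g x| ≤ 16 * π * (A * M) := by
  have h1 : conv K g x = ∫ y in Metric.closedBall x (4 * s), K (x - y) * g y := by
    refine (setIntegral_eq_integral_of_forall_compl_eq_zero fun y hy => ?_).symm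
    rw [Metric.mem_closedBall, dist_comm, dist_eq_norm, not_le] at hy
    simp [hs _ hy]
  rw [h1, ← Real.norm_eq_abs]
  refine (norm_setIntegral_le_of_norm_le_const (C := A / s ^ 2 * M) measure_closedBall_lt_top
    fun y hy => ?_).trans_eq ?_
  · rw [Metric.mem_closedBall, dist_comm, dist_eq_norm] at hy
    rw [norm_mul]
    exact mul_le_mul (hK _) (hg y hy) (norm_nonneg _) ((abs_nonneg _).trans (hK 0))
  · rw [volume_real_closedBall_plane x (by positivity)]
    field_simp
    ring

namespace IsPiece

variable {m : ℕ} {A s : ℝ} {K : Plane → ℝ}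

lemma const_nonneg (hK : IsPiece m A s K) (hs : 0 < s) : 0 ≤ A := by
  have := (abs_nonneg _).trans (hK.bound 0)
  by_contra h
  exact absurd this (not_le.2 (div_neg_of_neg_of_pos (not_le.1 h) (by positivity)))

lemma continuous (hK : IsPiece m A s K) : Continuous K := by
  have : LipschitzWith (A / s ^ 3).toNNReal K :=
    LipschitzWith.of_dist_le_mul fun z z' => by
      rw [Real.dist_eq, dist_eq_norm]
      exact (hK.lip z z').trans
        (mul_le_mul_of_nonneg_right (Real.le_coe_toNNReal _) (norm_nonneg _))
  exact this.continuous

lemma integrable (hK : IsPiece m A s K) {g : Plane → ℝ} {M : ℝ} {x : Plane}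
    (hgm : AEStronglyMeasurable g volume) (hg : ∀ y, ‖x - y‖ ≤ 4 * s → |g y| ≤ M) :
    Integrable fun y => K (x - y) * g y :=
  integrable_conv hK.continuous.measurable hK.bound hK.supp hgm hg

lemma abs_conv_sub_le (hK : IsPiece m A s K) (hs : 0 < s) {g : Plane → ℝ} {M : ℝ}
    (hgm : AEStronglyMeasurable g volume) {x x' : Plane}
    (hg : ∀ y, ‖x - y‖ ≤ 4 * s → |g y| ≤ M) (hg' : ∀ y, ‖x' - y‖ ≤ 4 * s → |g y| ≤ M) :
    |conv K g x - conv K g x'| ≤ 32 * π * (A * M) * (‖x - x'‖ / s) := by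
  have hA := hK.const_nonneg hs
  have hM : 0 ≤ M := (abs_nonneg _).trans (hg x (by simp; positivity))
  have h1 : conv K g x - conv K g x' = ∫ y in Metric.closedBall x (4 * s) ∪
      Metric.closedBall x' (4 * s), (K (x - y) - K (x' - y)) * g y := by
    rw [setIntegral_eq_integral_of_forall_compl_eq_zero, conv, conv,
      ← integral_sub (hK.integrable hgm hg) (hK.integrable hgm hg')]
    · simp only [sub_mul]
    · intro y hy
      simp only [Set.mem_union, Metric.mem_closedBall, dist_comm y, dist_eq_norm, not_or,
        not_le] at hy
      simp [hK.supp _ hy.1, hK.supp _ hy.2]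
  rw [h1, ← Real.norm_eq_abs]
  refine (norm_setIntegral_le_of_norm_le_const (C := A / s ^ 3 * ‖x - x'‖ * M)
    ((measure_union_le _ _).trans_lt
      (ENNReal.add_lt_top.2 ⟨measure_closedBall_lt_top, measure_closedBall_lt_top⟩))
    fun y hy => ?_).trans ?_
  · simp only [Set.mem_union, Metric.mem_closedBall, dist_comm y, dist_eq_norm] at hy
    rw [norm_mul]
    have h2 := hK.lip (x - y) (x' - y)
    rw [sub_sub_sub_cancel_right] at h2
    exact mul_le_mul h2 (hy.elim (hg y) (hg' y)) (norm_nonneg _) (by positivity)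
  · have h3 : volume.real (Metric.closedBall x (4 * s) ∪ Metric.closedBall x' (4 * s)) ≤
        π * (4 * s) ^ 2 + π * (4 * s) ^ 2 := by
      refine (measureReal_union_le _ _).trans_eq ?_
      rw [volume_real_closedBall_plane _ (by positivity),
        volume_real_closedBall_plane _ (by positivity)]
    refine (mul_le_mul_of_nonneg_left h3 (by positivity)).trans_eq ?_
    field_simp
    ring

lemma conv_zero (hK : IsPiece m A s K) (hm : 0 < m) {g : Plane → ℝ} {M : ℝ}
    (hgs : IsFoldSymmetric m g) (hgm : AEStronglyMeasurable g volume)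
    (hg : ∀ y, ‖y‖ ≤ 4 * s → |g y| ≤ M) : conv K g 0 = 0 := by
  have hi := hK.integrable (x := 0) hgm (M := M) (by simpa using hg)
  simp only [conv, zero_sub] at hi ⊢
  refine integral_mul_eq_zero_of_symmetrization (K := fun y => K (-y)) hm (fun z => ?_) hgs hi
  simp only [← rot_neg, hK.symm]

end IsPiece

lemma integral_eq_zero_of_symmetrization {m : ℕ} (hm : 0 < m) {K : Plane → ℝ}
    (hK : ∀ z, ∑ i ∈ Finset.Icc 1 m, K (rot (2 * π * i / m) z) = 0) (hi : Integrable K) :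
    ∫ z, K z = 0 := by
  have := integral_mul_eq_zero_of_symmetrization (f := fun _ => 1) hm hK (fun _ => rfl)
    (by simpa using hi)
  simpa using this

/-- Kernels of mean zero only see the oscillation of the function they are convolved with. -/
lemma conv_sub_const {K g : Plane → ℝ} (c : ℝ) {x : Plane} (hKi : Integrable K)
    (hK0 : ∫ z, K z = 0) (hi : Integrable fun y => K (x - y) * g y) :
    conv K (fun y => g y - c) x = conv K g x := by
  have h : ∫ y, K (x - y) * c = 0 := by
    rw [integral_mul_const, integral_sub_left_eq_self K volume x, hK0, zero_mul]
  have hc : Integrable fun y => K (x - y) * c := (hKi.comp_sub_left x).mul_const c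
  simp only [conv, mul_sub]
  rw [integral_sub hi hc, h, sub_zero]

/-! ### Dyadic sums -/

/-- The two-sided geometric weight at the dyadic scale `2^k` relative to the length `s`. -/
noncomputable def dyadicWeight (a b s : ℝ) (k : ℤ) : ℝ :=
  min (((2 : ℝ) ^ k / s) ^ a) (((2 : ℝ) ^ k / s) ^ (-b))

lemma dyadicWeight_nonneg (a b : ℝ) {s : ℝ} (hs : 0 ≤ s) (k : ℤ) : 0 ≤ dyadicWeight a b s k :=
  le_min (by positivity) (by positivity)

lemma summable_pow_natAbs {ρ : ℝ} (h0 : 0 ≤ ρ) (h1 : ρ < 1) :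
    Summable fun k : ℤ => ρ ^ k.natAbs := by
  refine Summable.of_nat_of_neg ?_ ?_ <;> simpa using summable_geometric_of_lt_one h0 h1

lemma abs_tsum_le {F : ℤ → ℝ} (h : Summable fun k => |F k|) : |∑' k, F k| ≤ ∑' k, |F k| := by
  simpa only [Real.norm_eq_abs] using
    norm_tsum_le_tsum_norm (f := F) (by simpa only [Real.norm_eq_abs] using h)

lemma exists_dyadicWeight_bound {a b : ℝ} (ha : 0 < a) (hb : 0 < b) :
    ∃ C : ℝ, 0 ≤ C ∧ ∀ s : ℝ, 0 < s →
      Summable (dyadicWeight a b s) ∧ ∑' k, dyadicWeight a b s k ≤ C := by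
  set ρ : ℝ := (2 : ℝ) ^ (-(min a b)) with hρ
  have hρ0 : 0 < ρ := by positivity
  have hρ1 : ρ < 1 := rpow_lt_one_of_one_lt_of_neg one_lt_two (by simp [ha, hb])
  have hsum := summable_pow_natAbs hρ0.le hρ1
  refine ⟨(2 : ℝ) ^ b * ∑' k : ℤ, ρ ^ k.natAbs,
    mul_nonneg (by positivity) (tsum_nonneg fun k => by positivity), fun s hs => ?_⟩
  obtain ⟨n, hn1, hn2⟩ := exists_mem_Ico_zpow hs one_lt_two
  have hle : ∀ k, dyadicWeight a b s k ≤ (2 : ℝ) ^ b * ρ ^ (k - n).natAbs := by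
    intro k
    have hk : (0 : ℝ) < 2 ^ k := by positivity
    have hb1 : (1 : ℝ) ≤ 2 ^ b := one_le_rpow one_le_two hb.le
    rcases le_total k n with h | h
    · obtain ⟨j, rfl⟩ : ∃ j : ℕ, n = k + j := ⟨(n - k).toNat, by omega⟩
      have h1 : (2 : ℝ) ^ k / s ≤ 2 ^ (-(j : ℝ)) := by
        rw [div_le_iff₀ hs]
        refine le_trans (le_of_eq ?_) (mul_le_mul_of_nonneg_left hn1 (by positivity))
        rw [zpow_add₀ two_ne_zero, rpow_neg two_pos.le, rpow_natCast, zpow_natCast]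
        field_simp
      have h2 : (k - (k + (j : ℤ))).natAbs = j := by omega
      rw [h2]
      calc dyadicWeight a b s k ≤ ((2 : ℝ) ^ k / s) ^ a := min_le_left _ _
        _ ≤ (2 ^ (-(j : ℝ))) ^ a := rpow_le_rpow (by positivity) h1 ha.le
        _ = 2 ^ (-(j * a)) := by rw [← rpow_mul two_pos.le, neg_mul]
        _ ≤ 2 ^ (-(min a b) * j) := by
          refine rpow_le_rpow_of_exponent_le one_le_two ?_
          have := mul_le_mul_of_nonneg_left (min_le_left a b) (Nat.cast_nonneg (α := ℝ) j)
          linarith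
        _ = ρ ^ j := by rw [rpow_mul two_pos.le, rpow_natCast]
        _ ≤ _ := le_mul_of_one_le_left (by positivity) hb1
    · obtain ⟨j, rfl⟩ : ∃ j : ℕ, k = n + j := ⟨(k - n).toNat, by omega⟩
      have h1 : (2 : ℝ) ^ ((j : ℝ) - 1) ≤ (2 : ℝ) ^ (n + (j : ℤ)) / s := by
        rw [le_div_iff₀ hs]
        refine (mul_le_mul_of_nonneg_left hn2.le (by positivity)).trans_eq ?_
        rw [zpow_add₀ two_ne_zero, zpow_add₀ two_ne_zero, rpow_sub two_pos, rpow_natCast,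
          zpow_natCast]
        simp
        field_simp
      have h2 : (n + (j : ℤ) - n).natAbs = j := by omega
      rw [h2]
      calc dyadicWeight a b s (n + j) ≤ ((2 : ℝ) ^ (n + (j : ℤ)) / s) ^ (-b) := min_le_right _ _
        _ ≤ (2 ^ ((j : ℝ) - 1)) ^ (-b) :=
          rpow_le_rpow_of_nonpos (by positivity) h1 (by linarith)
        _ = 2 ^ b * 2 ^ (-(j * b)) := by
          rw [← rpow_mul two_pos.le, ← rpow_add two_pos]; congr 1; ring
        _ ≤ 2 ^ b * 2 ^ (-(min a b) * j) := by
          refine mul_le_mul_of_nonneg_left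
            (rpow_le_rpow_of_exponent_le one_le_two ?_) (by positivity)
          have := mul_le_mul_of_nonneg_left (min_le_right a b) (Nat.cast_nonneg (α := ℝ) j)
          linarith
        _ = 2 ^ b * ρ ^ j := by rw [rpow_mul two_pos.le (-(min a b)), rpow_natCast]
  have hsum' : Summable fun k : ℤ => (2 : ℝ) ^ b * ρ ^ (k - n).natAbs :=
    ((Equiv.subRight n).summable_iff.2 hsum).mul_left _
  have hS := Summable.of_nonneg_of_le (fun k => dyadicWeight_nonneg a b hs.le k) hle hsum'
  refine ⟨hS, (hS.tsum_le_tsum hle hsum').trans_eq ?_⟩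
  rw [tsum_mul_left]
  congr 1
  exact (Equiv.subRight n).tsum_eq fun k : ℤ => ρ ^ k.natAbs

/-! ### Superposition of kernels over all dyadic scales -/

namespace IsPiece

variable {m : ℕ} {A s : ℝ} {K : Plane → ℝ}

lemma integrable_self (hK : IsPiece m A s K) : Integrable K := by
  have h := (hK.integrable (x := 0) (g := fun _ => 1) (M := 1)
    aestronglyMeasurable_const (by simp)).comp_neg
  simpa using h

lemma integral_eq_zero (hK : IsPiece m A s K) (hm : 0 < m) : ∫ z, K z = 0 :=
  integral_eq_zero_of_symmetrization hm hK.symm hK.integrable_self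

end IsPiece

lemma rpow_four_mul_div_le {α t r : ℝ} (hα1 : α ≤ 1) (ht : 0 ≤ t) (hr : 0 ≤ r) :
    (4 * t / r) ^ α ≤ 4 * (t / r) ^ α := by
  rw [mul_div_assoc, mul_rpow (by norm_num) (by positivity)]
  refine mul_le_mul_of_nonneg_right ?_ (by positivity)
  calc (4 : ℝ) ^ α ≤ 4 ^ (1 : ℝ) := rpow_le_rpow_of_exponent_le (by norm_num) hα1
    _ = 4 := rpow_one _

/-- A bounded kernel of mean zero at scale `s`, not necessarily continuous, gains the factor
`(s / |x|)^α`. -/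
lemma abs_conv_le_of_mean_zero {α N A s : ℝ} {K f : Plane → ℝ} (hα0 : 0 < α) (hα1 : α ≤ 1)
    (hf : RingBound α N f) (hs : 0 < s) (hKm : Measurable K)
    (hKb : ∀ z, |K z| ≤ A / s ^ 2) (hKs : ∀ z, 4 * s < ‖z‖ → K z = 0) (hKi : Integrable K)
    (hK0 : ∫ z, K z = 0) {x : Plane} (hx : x ≠ 0) :
    |conv K f x| ≤ 128 * π * A * N * (s / ‖x‖) ^ α := by
  have hN := hf.nonneg
  have hi := integrable_conv (x := x) (r := 4 * s) hKm hKb hKs (hf.aestronglyMeasurable hα0)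
    fun y _ => hf.bound y
  rw [← conv_sub_const (f x) hKi hK0 hi]
  refine (abs_conv_le hs hKb hKs (M := 2 * N * (4 * (s / ‖x‖) ^ α)) fun y hy => ?_).trans_eq
    (by ring)
  refine (hf.abs_sub_le hα0.le hα1 hx y).trans (mul_le_mul_of_nonneg_left ?_ (by positivity))
  refine (rpow_le_rpow (by positivity) ?_ hα0.le).trans
    (rpow_four_mul_div_le hα1 hs.le (norm_nonneg x))
  exact div_le_div_of_nonneg_right hy (norm_nonneg x)

section Superposition

variable {m : ℕ} {α N A : ℝ} {K : ℤ → Plane → ℝ} {f : Plane → ℝ}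

lemma abs_conv_piece_le (hα0 : 0 < α) (hα1 : α ≤ 1) (hm : 0 < m) (hf : RingBound α N f)
    (hK : ∀ k : ℤ, IsPiece m A (2 ^ k) (K k)) (k : ℤ) {x : Plane} (hx : x ≠ 0) :
    |conv (K k) f x| ≤ 128 * π * A * N * ((2 : ℝ) ^ k / ‖x‖) ^ α :=
  abs_conv_le_of_mean_zero hα0 hα1 hf (by positivity)
    (hK k).continuous.measurable (hK k).bound (hK k).supp (hK k).integrable_self
    ((hK k).integral_eq_zero hm) hx

/-- At scales larger than `|x|` the cancellation at the origin, forced by the rotational symmetry,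
yields decay. -/
lemma abs_conv_piece_le' (hm : 0 < m) (hfm : AEStronglyMeasurable f volume) (hfb : ∀ y, |f y| ≤ N)
    (hfs : IsFoldSymmetric m f) (hK : ∀ k : ℤ, IsPiece m A (2 ^ k) (K k)) (k : ℤ) (x : Plane) :
    |conv (K k) f x| ≤ 32 * π * A * N * (‖x‖ / (2 : ℝ) ^ k) := by
  have h := (hK k).abs_conv_sub_le (by positivity) hfm (x := x) (x' := 0)
    (fun y _ => hfb y) fun y _ => hfb y
  rw [(hK k).conv_zero hm hfs hfm fun y _ => hfb y, sub_zero, sub_zero] at h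
  exact h.trans_eq (by ring)

lemma abs_conv_piece_le_weight (hα0 : 0 < α) (hα1 : α ≤ 1) (hm : 0 < m) (hf : RingBound α N f)
    (hfs : IsFoldSymmetric m f) (hK : ∀ k : ℤ, IsPiece m A (2 ^ k) (K k)) (k : ℤ) {x : Plane}
    (hx : x ≠ 0) :
    |conv (K k) f x| ≤ 128 * π * A * N * dyadicWeight α 1 ‖x‖ k := by
  have hA := (hK k).const_nonneg (by positivity)
  have hN := hf.nonneg
  rw [dyadicWeight, mul_min_of_nonneg _ _ (by positivity)]
  refine le_min (abs_conv_piece_le hα0 hα1 hm hf hK k hx) ?_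
  refine (abs_conv_piece_le' hm (hf.aestronglyMeasurable hα0) hf.bound hfs hK k x).trans ?_
  rw [rpow_neg_one, inv_div]
  gcongr
  norm_num

/-- The Hölder estimate for one scale. -/
lemma abs_conv_piece_sub_le_weight (hα0 : 0 < α) (hα1 : α ≤ 1) (hm : 0 < m) (hf : RingBound α N f)
    (hK : ∀ k : ℤ, IsPiece m A (2 ^ k) (K k)) (k : ℤ) {x x' : Plane}
    (hx : x ≠ 0) (hxx : ‖x‖ ≤ ‖x'‖) (hne : x ≠ x') :
    ‖x‖ ^ α * |conv (K k) f x - conv (K k) f x'| ≤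
      320 * π * A * N * ‖x - x'‖ ^ α * dyadicWeight α (1 - α) ‖x - x'‖ k := by
  have h2k : (0 : ℝ) < 2 ^ k := by positivity
  have hA := (hK k).const_nonneg h2k
  have hN := hf.nonneg
  have hx0 : 0 < ‖x‖ := norm_pos_iff.2 hx
  have hx' : x' ≠ 0 := norm_pos_iff.1 (hx0.trans_le hxx)
  have hxα : 0 < ‖x‖ ^ α := rpow_pos_of_pos hx0 _
  set h := ‖x - x'‖ with hh
  have hpos : 0 < h := norm_pos_iff.2 (sub_ne_zero.2 hne)
  have hhα : 0 < h ^ α := rpow_pos_of_pos hpos _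
  -- the triangle inequality suffices at scales below `h`
  have hsmall : ‖x‖ ^ α * |conv (K k) f x - conv (K k) f x'| ≤
      320 * π * A * N * h ^ α * ((2 : ℝ) ^ k / h) ^ α := by
    have h1 := abs_conv_piece_le hα0 hα1 hm hf hK k hx
    have h2 := abs_conv_piece_le hα0 hα1 hm hf hK k hx'
    have h3 : ((2 : ℝ) ^ k / ‖x'‖) ^ α ≤ ((2 : ℝ) ^ k / ‖x‖) ^ α := by gcongr
    calc ‖x‖ ^ α * |conv (K k) f x - conv (K k) f x'|
        ≤ ‖x‖ ^ α * (128 * π * A * N * ((2 : ℝ) ^ k / ‖x‖) ^ α +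
            128 * π * A * N * ((2 : ℝ) ^ k / ‖x‖) ^ α) := by
          refine mul_le_mul_of_nonneg_left ?_ hxα.le
          refine (abs_sub _ _).trans (add_le_add h1 (h2.trans ?_))
          gcongr
      _ = 256 * π * A * N * ((2 : ℝ) ^ k) ^ α := by
          rw [div_rpow h2k.le hx0.le]; field_simp; ring
      _ ≤ 320 * π * A * N * ((2 : ℝ) ^ k) ^ α := by gcongr; norm_num
      _ = _ := by rw [div_rpow h2k.le hpos.le]; field_simp
  rw [dyadicWeight, mul_min_of_nonneg _ _ (by positivity)]
  refine le_min hsmall ?_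
  rcases lt_or_ge ((2 : ℝ) ^ k) h with hlt | hge
  · refine hsmall.trans (mul_le_mul_of_nonneg_left ?_ (by positivity))
    exact rpow_le_rpow_of_exponent_ge (by positivity) ((div_le_one hpos).2 hlt.le) (by linarith)
  · have hfm := hf.aestronglyMeasurable hα0
    have hb : ∀ y, ‖x - y‖ ≤ 5 * (2 : ℝ) ^ k →
        |f y - f x| ≤ 2 * N * (5 * ((2 : ℝ) ^ k / ‖x‖) ^ α) := fun y hy => by
      refine (hf.abs_sub_le hα0.le hα1 hx y).trans (mul_le_mul_of_nonneg_left ?_ (by positivity))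
      calc (‖x - y‖ / ‖x‖) ^ α ≤ (5 * ((2 : ℝ) ^ k / ‖x‖)) ^ α := by
            rw [← mul_div_assoc]; gcongr
        _ = 5 ^ α * ((2 : ℝ) ^ k / ‖x‖) ^ α := mul_rpow (by norm_num) (by positivity)
        _ ≤ 5 ^ (1 : ℝ) * ((2 : ℝ) ^ k / ‖x‖) ^ α := by gcongr; norm_num
        _ = _ := by rw [rpow_one]
    have hKi := (hK k).integrable_self
    have hK0 := (hK k).integral_eq_zero hm
    have key := (hK k).abs_conv_sub_le h2k (g := fun y => f y - f x) (x := x) (x' := x')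
      (hfm.sub aestronglyMeasurable_const)
      (fun y hy => hb y (hy.trans (by linarith)))
      (fun y hy => hb y (by
        have := norm_sub_le_norm_sub_add_norm_sub x x' y
        linarith))
    rw [conv_sub_const (f x) hKi hK0 ((hK k).integrable hfm fun y _ => hf.bound y),
      conv_sub_const (f x) hKi hK0 ((hK k).integrable hfm fun y _ => hf.bound y)] at key
    refine (mul_le_mul_of_nonneg_left key hxα.le).trans_eq ?_
    rw [neg_sub, rpow_sub (by positivity), rpow_one, div_rpow h2k.le hx0.le,
      div_rpow h2k.le hpos.le, ← hh]
    field_simp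
    ring

/-- The basic estimate: the superposition over all dyadic scales of kernels of mean zero with
vanishing symmetrization is bounded on the `m`-fold symmetric functions of the critical space, with
a bound that does not depend on `m`. -/
theorem exists_superposition_bound (hα0 : 0 < α) (hα1 : α < 1) :
    ∃ C : ℝ, 0 ≤ C ∧ ∀ (m : ℕ) (A N : ℝ) (K : ℤ → Plane → ℝ) (f : Plane → ℝ), 0 < m →
      RingBound α N f → IsFoldSymmetric m f → (∀ k : ℤ, IsPiece m A (2 ^ k) (K k)) →
      (∀ x, Summable fun k => |conv (K k) f x|) ∧ (∀ x, ∑' k, |conv (K k) f x| ≤ C * A * N) ∧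
        RingBound α (C * A * N) fun x => ∑' k, conv (K k) f x := by
  obtain ⟨C₁, hC₁, h₁⟩ := exists_dyadicWeight_bound hα0 one_pos
  obtain ⟨C₂, hC₂, h₂⟩ := exists_dyadicWeight_bound hα0 (sub_pos.2 hα1)
  refine ⟨128 * π * C₁ + 320 * π * C₂, by positivity, fun m A N K f hm hf hfs hK => ?_⟩
  have hA := (hK 0).const_nonneg (by positivity)
  have hN := hf.nonneg
  have hzero : ∀ k, conv (K k) f 0 = 0 := fun k =>
    (hK k).conv_zero hm hfs (hf.aestronglyMeasurable hα0) fun y _ => hf.bound y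
  have hle : ∀ x, x ≠ 0 → ∀ k, |conv (K k) f x| ≤ 128 * π * A * N * dyadicWeight α 1 ‖x‖ k :=
    fun x hx k => abs_conv_piece_le_weight hα0 hα1.le hm hf hfs hK k hx
  have hsum : ∀ x, Summable fun k => |conv (K k) f x| := fun x => by
    rcases eq_or_ne x 0 with rfl | hx
    · simp [hzero, summable_zero]
    · exact Summable.of_nonneg_of_le (fun _ => abs_nonneg _) (hle x hx)
        ((h₁ ‖x‖ (norm_pos_iff.2 hx)).1.mul_left _)
  have hbd : ∀ x, ∑' k, |conv (K k) f x| ≤ 128 * π * C₁ * A * N := fun x => by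
    rcases eq_or_ne x 0 with rfl | hx
    · simp only [hzero, abs_zero, tsum_zero]; positivity
    · have h := h₁ ‖x‖ (norm_pos_iff.2 hx)
      refine ((hsum x).tsum_le_tsum (hle x hx) (h.1.mul_left _)).trans ?_
      rw [tsum_mul_left]
      calc _ ≤ 128 * π * A * N * C₁ := by gcongr; exact h.2
        _ = _ := by ring
  have habs : ∀ x, |∑' k, conv (K k) f x| ≤ 128 * π * C₁ * A * N := fun x =>
    (abs_tsum_le (hsum x)).trans (hbd x)
  have hweak : 128 * π * C₁ * A * N ≤ (128 * π * C₁ + 320 * π * C₂) * A * N := by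
    have : 0 ≤ 320 * π * C₂ * A * N := by positivity
    linarith
  refine ⟨hsum, fun x => (hbd x).trans hweak, fun x => (habs x).trans hweak, fun x x' => ?_⟩
  wlog hxx : ‖x‖ ≤ ‖x'‖ generalizing x x'
  · rw [abs_sub_comm, norm_sub_rev]; exact this x' x (le_of_not_ge hxx)
  rcases eq_or_ne x x' with rfl | hne
  · simp; positivity
  set T := fun x => ∑' k, conv (K k) f x with hT
  have hpos : 0 < ‖x - x'‖ := norm_pos_iff.2 (sub_ne_zero.2 hne)
  have hmain : ‖x‖ ^ α * |T x - T x'| ≤ 320 * π * C₂ * A * N * ‖x - x'‖ ^ α := by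
    rcases eq_or_ne x 0 with rfl | hx
    · rw [norm_zero, zero_rpow hα0.ne', zero_mul]; positivity
    have hd : T x - T x' = ∑' k, (conv (K k) f x - conv (K k) f x') :=
      ((hsum x).of_abs.tsum_sub (hsum x').of_abs).symm
    have hw := h₂ _ hpos
    have hle2 := fun k => abs_conv_piece_sub_le_weight hα0 hα1.le hm hf hK k hx hxx hne
    have hs2 : Summable fun k => ‖x‖ ^ α * |conv (K k) f x - conv (K k) f x'| :=
      Summable.of_nonneg_of_le (fun _ => by positivity) hle2 (hw.1.mul_left _)
    have hxα : ‖x‖ ^ α ≠ 0 := (rpow_pos_of_pos (norm_pos_iff.2 hx) _).ne'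
    have hs3 : Summable fun k => |conv (K k) f x - conv (K k) f x'| :=
      (summable_mul_left_iff hxα).1 hs2
    calc ‖x‖ ^ α * |T x - T x'| ≤ ‖x‖ ^ α * ∑' k, |conv (K k) f x - conv (K k) f x'| := by
          rw [hd]
          exact mul_le_mul_of_nonneg_left (abs_tsum_le hs3) (by positivity)
      _ = ∑' k, ‖x‖ ^ α * |conv (K k) f x - conv (K k) f x'| := tsum_mul_left.symm
      _ ≤ ∑' k, 320 * π * A * N * ‖x - x'‖ ^ α * dyadicWeight α (1 - α) ‖x - x'‖ k :=
          hs2.tsum_le_tsum hle2 (hw.1.mul_left _)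
      _ ≤ 320 * π * A * N * ‖x - x'‖ ^ α * C₂ := by
          rw [tsum_mul_left]; gcongr; exact hw.2
      _ = _ := by ring
  calc |‖x‖ ^ α * T x - ‖x'‖ ^ α * T x'|
      = |‖x‖ ^ α * (T x - T x') + (‖x‖ ^ α - ‖x'‖ ^ α) * T x'| := by congr 1; ring
    _ ≤ ‖x‖ ^ α * |T x - T x'| + |‖x‖ ^ α - ‖x'‖ ^ α| * |T x'| := by
        refine (abs_add_le _ _).trans_eq ?_
        rw [abs_mul, abs_mul, abs_of_nonneg (by positivity : (0 : ℝ) ≤ ‖x‖ ^ α)]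
    _ ≤ 320 * π * C₂ * A * N * ‖x - x'‖ ^ α + ‖x - x'‖ ^ α * (128 * π * C₁ * A * N) := by
        refine add_le_add hmain (mul_le_mul (abs_norm_rpow_sub_le hα0.le hα1.le x x') (habs x')
          (abs_nonneg _) (by positivity))
    _ = _ := by ring

end Superposition

/-! ### Dyadic decomposition of a homogeneous kernel -/

lemma hasCompactSupport_of_norm {φ : Plane → ℝ} {r : ℝ} (h : ∀ z, r < ‖z‖ → φ z = 0) :
    HasCompactSupport φ :=
  HasCompactSupport.intro (isCompact_closedBall 0 r) fun z hz => h z (by simpa using hz)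

/-- The dilations of a fixed smooth kernel of compact support are pieces, with a constant that does
not depend on the order of the symmetry. -/
lemma exists_isPiece_dilation {φ : Plane → ℝ} (hφ : ContDiff ℝ 1 φ)
    (hs : ∀ z, 4 < ‖z‖ → φ z = 0) :
    ∃ A : ℝ, ∀ m : ℕ, (∀ z, ∑ i ∈ Finset.Icc 1 m, φ (rot (2 * π * i / m) z) = 0) →
      ∀ s : ℝ, 0 < s → IsPiece m A s fun z => φ (s⁻¹ • z) / s ^ 2 := by
  have hc := hasCompactSupport_of_norm hs
  obtain ⟨L, hL⟩ := hφ.lipschitzWith_of_hasCompactSupport hc one_ne_zero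
  obtain ⟨B, hB⟩ := hc.exists_bound_of_continuous hφ.continuous
  refine ⟨max B L, fun m hm s hs0 => ⟨fun z => ?_, fun z z' => ?_, fun z hz => ?_, fun z => ?_⟩⟩
  · rw [abs_div, abs_of_pos (by positivity : 0 < s ^ 2)]
    gcongr
    exact (hB _).trans (le_max_left _ _)
  · rw [← sub_div, abs_div, abs_of_pos (by positivity : 0 < s ^ 2), div_le_iff₀ (by positivity)]
    have h := hL.dist_le_mul (s⁻¹ • z) (s⁻¹ • z')
    rw [Real.dist_eq, dist_eq_norm, ← smul_sub, norm_smul, Real.norm_eq_abs,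
      abs_of_pos (by positivity : 0 < s⁻¹)] at h
    refine h.trans ((mul_le_mul_of_nonneg_right (le_max_right B L) (by positivity)).trans_eq ?_)
    field_simp
  · rw [hs, zero_div]
    rw [norm_smul, Real.norm_eq_abs, abs_of_pos (by positivity : 0 < s⁻¹), inv_mul_eq_div,
      lt_div_iff₀ hs0]
    exact hz
  · simp only [← rot_smul, ← Finset.sum_div, hm, zero_div]

/-- A smooth radial cutoff: `1` on the unit disc and `0` outside the disc of radius two. -/
noncomputable def radialCutoff (z : Plane) : ℝ := smoothTransition ((4 - ‖z‖ ^ 2) / 3)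

lemma contDiff_radialCutoff : ContDiff ℝ ∞ radialCutoff :=
  smoothTransition.contDiff.comp ((contDiff_const.sub (contDiff_norm_sq ℝ)).div_const 3)

lemma radialCutoff_eq_one {z : Plane} (hz : ‖z‖ ≤ 1) : radialCutoff z = 1 := by
  refine smoothTransition.one_of_one_le ?_
  nlinarith [norm_nonneg z]

lemma radialCutoff_eq_zero {z : Plane} (hz : 2 ≤ ‖z‖) : radialCutoff z = 0 := by
  refine smoothTransition.zero_of_nonpos ?_
  nlinarith

lemma radialCutoff_rot (θ : ℝ) (z : Plane) : radialCutoff (rot θ z) = radialCutoff z := by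
  rw [radialCutoff, radialCutoff, norm_rot]

/-- A smooth radial function supported in the annulus `1/2 ≤ |z| ≤ 2` whose dyadic dilations form
a partition of unity away from the origin. -/
noncomputable def annularCutoff (z : Plane) : ℝ := radialCutoff z - radialCutoff ((2 : ℝ) • z)

lemma contDiff_annularCutoff : ContDiff ℝ ∞ annularCutoff :=
  contDiff_radialCutoff.sub (contDiff_radialCutoff.comp (contDiff_const_smul _))

lemma norm_smul_of_pos {c : ℝ} (hc : 0 < c) (z : Plane) : ‖c • z‖ = c * ‖z‖ := by
  rw [norm_smul, Real.norm_eq_abs, abs_of_pos hc]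

lemma annularCutoff_eq_zero_of_le {z : Plane} (hz : ‖z‖ ≤ 1 / 2) : annularCutoff z = 0 := by
  have h2 : ‖(2 : ℝ) • z‖ ≤ 1 := by rw [norm_smul_of_pos two_pos]; linarith
  rw [annularCutoff, radialCutoff_eq_one (by linarith), radialCutoff_eq_one h2, sub_self]

lemma annularCutoff_eq_zero_of_ge {z : Plane} (hz : 2 ≤ ‖z‖) : annularCutoff z = 0 := by
  have h2 : 2 ≤ ‖(2 : ℝ) • z‖ := by rw [norm_smul_of_pos two_pos]; linarith
  rw [annularCutoff, radialCutoff_eq_zero hz, radialCutoff_eq_zero h2, sub_self]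

lemma annularCutoff_rot (θ : ℝ) (z : Plane) : annularCutoff (rot θ z) = annularCutoff z := by
  rw [annularCutoff, annularCutoff, ← rot_smul, radialCutoff_rot, radialCutoff_rot]

lemma sum_annularCutoff_eq_one (n : ℤ) (M : ℕ) {z : Plane} (h1 : (2 : ℝ) ^ n ≤ ‖z‖)
    (h2 : ‖z‖ ≤ (2 : ℝ) ^ (n + M)) :
    ∑ j ∈ Finset.range (M + 1), annularCutoff (((2 : ℝ) ^ (n + (j : ℤ)))⁻¹ • z) = 1 := by
  have hstep : ∀ j : ℕ, annularCutoff (((2 : ℝ) ^ (n + (j : ℤ)))⁻¹ • z) =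
      radialCutoff (((2 : ℝ) ^ (n + ((j + 1 : ℕ) : ℤ) - 1))⁻¹ • z) -
        radialCutoff (((2 : ℝ) ^ (n + (j : ℤ) - 1))⁻¹ • z) := by
    intro j
    rw [annularCutoff, smul_smul]
    congr 3
    · congr 2; push_cast; ring
    · rw [zpow_sub_one₀ two_ne_zero]; field_simp
  simp only [hstep]
  rw [Finset.sum_range_sub (fun j : ℕ => radialCutoff (((2 : ℝ) ^ (n + (j : ℤ) - 1))⁻¹ • z))]
  rw [radialCutoff_eq_one, radialCutoff_eq_zero, sub_zero]
  · rw [norm_smul_of_pos (by positivity), inv_mul_eq_div, le_div_iff₀ (by positivity)]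
    simp only [Nat.cast_zero, add_zero]
    rw [zpow_sub_one₀ two_ne_zero]
    linarith
  · rw [norm_smul_of_pos (by positivity), inv_mul_eq_div, div_le_one (by positivity)]
    refine h2.trans_eq ?_
    congr 1; push_cast; ring

/-- The part of the kernel `P` at the dyadic scale `2^k`. -/
noncomputable def dyadicPart (P : Plane → ℝ) (k : ℤ) (z : Plane) : ℝ :=
  P z * annularCutoff (((2 : ℝ) ^ k)⁻¹ • z)

lemma dyadicPart_eq_zero_of_le (P : Plane → ℝ) {k : ℤ} {z : Plane} (hz : 2 * ‖z‖ ≤ (2 : ℝ) ^ k) :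
    dyadicPart P k z = 0 := by
  rw [dyadicPart, annularCutoff_eq_zero_of_le, mul_zero]
  rw [norm_smul_of_pos (by positivity), inv_mul_eq_div, div_le_iff₀ (by positivity)]
  linarith

lemma dyadicPart_eq_zero_of_ge (P : Plane → ℝ) {k : ℤ} {z : Plane} (hz : 2 * (2 : ℝ) ^ k ≤ ‖z‖) :
    dyadicPart P k z = 0 := by
  rw [dyadicPart, annularCutoff_eq_zero_of_ge, mul_zero]
  rwa [norm_smul_of_pos (by positivity), inv_mul_eq_div, le_div_iff₀ (by positivity)]

/-- At `x = 0` the decay condition forces the symmetrization of the kernel to vanish. This is the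
only consequence of the condition that is needed, and its constants play no role. -/
lemma HasIntegrableSymmetrization.sum_eq_zero {m : ℕ} {P : Plane → ℝ}
    (h : HasIntegrableSymmetrization m P) {z : Plane} (hz : z ≠ 0) :
    ∑ i ∈ Finset.Icc 1 m, P (rot (2 * π * i / m) z) = 0 := by
  obtain ⟨C, c, hC, hc, h⟩ := h
  have := h 0 (-z) (neg_ne_zero.2 hz) (by simp)
  simpa [rot_neg] using this

lemma IsSingularKernel.exists_isPiece {P : Plane → ℝ} (hP : IsSingularKernel P) :
    ∃ A : ℝ, ∀ m : ℕ, HasIntegrableSymmetrization m P →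
      ∀ k : ℤ, IsPiece m A (2 ^ k) (dyadicPart P k) := by
  have hcd : ContDiff ℝ 1 fun z => P z * annularCutoff z := by
    rw [contDiff_iff_contDiffAt]
    intro z
    rcases eq_or_ne z 0 with rfl | hz
    · have h0 : (fun z => P z * annularCutoff z) =ᶠ[𝓝 0] fun _ => 0 := by
        filter_upwards [Metric.ball_mem_nhds (0 : Plane) (by norm_num : (0 : ℝ) < 1 / 2)] with z hz
        rw [annularCutoff_eq_zero_of_le, mul_zero]
        exact (mem_ball_zero_iff.1 hz).le
      exact contDiffAt_const.congr_of_eventuallyEq h0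
    · have h1 : ContDiffAt ℝ 1 P z := ((hP.smooth z hz).contDiffAt
        (isOpen_compl_singleton.mem_nhds hz)).of_le (by exact_mod_cast le_top)
      exact h1.mul (contDiff_annularCutoff.contDiffAt.of_le (by exact_mod_cast le_top))
  obtain ⟨A, hA⟩ := exists_isPiece_dilation hcd fun z hz => by
    rw [annularCutoff_eq_zero_of_ge (by linarith), mul_zero]
  refine ⟨A, fun m hm k => ?_⟩
  have h := hA m (fun z => ?_) (2 ^ k) (by positivity)
  · convert h using 2 with z
    rcases eq_or_ne z 0 with rfl | hz
    · simp [dyadicPart, annularCutoff_eq_zero_of_le]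
    · rw [dyadicPart, hP.homogeneous _ z (by positivity) hz, inv_inv]
      field_simp
  · simp only [annularCutoff_rot, ← Finset.sum_mul]
    rcases eq_or_ne z 0 with rfl | hz
    · simp [annularCutoff_eq_zero_of_le]
    · rw [hm.sum_eq_zero hz, zero_mul]

/-! ### Existence of the principal value -/

/-- The part at scale `2^k` of the doubly truncated integral. -/
noncomputable def truncatedPart (P g : Plane → ℝ) (x : Plane) (p : ℝ × ℝ) (k : ℤ) : ℝ :=
  ∫ y in {y : Plane | p.1 < ‖x - y‖ ∧ ‖y‖ ≤ p.2}, dyadicPart P k (x - y) * g y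

lemma measurableSet_truncation (x : Plane) (ε R : ℝ) :
    MeasurableSet {y : Plane | ε < ‖x - y‖ ∧ ‖y‖ ≤ R} :=
  (measurableSet_lt measurable_const (measurable_const.sub measurable_id).norm).inter
    (measurableSet_le measurable_norm measurable_const)

section PrincipalValue

variable {m : ℕ} {α N A : ℝ} {P g : Plane → ℝ}

lemma tsum_truncatedPart (hα0 : 0 < α) (hg : RingBound α N g)
    (hK : ∀ k : ℤ, IsPiece m A (2 ^ k) (dyadicPart P k)) (x : Plane) {ε R : ℝ} (hε : 0 < ε) :
    ∑' k, truncatedPart P g x (ε, R) k =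
      ∫ y in {y : Plane | ε < ‖x - y‖ ∧ ‖y‖ ≤ R}, P (x - y) * g y := by
  have hmeas := measurableSet_truncation x ε R
  obtain ⟨n, hn, -⟩ := exists_mem_Ico_zpow hε one_lt_two
  obtain ⟨M, hM⟩ := pow_unbounded_of_one_lt ((‖x‖ + R) / (2 : ℝ) ^ n) one_lt_two
  rw [div_lt_iff₀ (by positivity)] at hM
  have hM' : ‖x‖ + R ≤ (2 : ℝ) ^ (n + (M : ℤ)) := by
    rw [zpow_add₀ two_ne_zero, zpow_natCast]; linarith
  have hupper : ∀ y ∈ {y : Plane | ε < ‖x - y‖ ∧ ‖y‖ ≤ R}, ‖x - y‖ ≤ (2 : ℝ) ^ (n + (M : ℤ)) :=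
    fun y hy => ((norm_sub_le x y).trans (by linarith [hy.2])).trans hM'
  obtain ⟨e, he⟩ : ∃ e : ℕ ↪ ℤ, ∀ j : ℕ, e j = n + (j : ℤ) :=
    ⟨⟨fun j => n + (j : ℤ), (add_right_injective n).comp Nat.cast_injective⟩, fun _ => rfl⟩
  have hout : ∀ k ∉ (Finset.range (M + 1)).map e, truncatedPart P g x (ε, R) k = 0 := by
    intro k hk
    refine setIntegral_eq_zero_of_forall_eq_zero fun y hy => ?_
    have hcase : k + 1 ≤ n ∨ n + (M : ℤ) + 1 ≤ k := by
      by_contra! h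
      refine hk (Finset.mem_map.2 ⟨(k - n).toNat, ?_, ?_⟩)
      · rw [Finset.mem_range]; omega
      · rw [he]
        omega
    rcases hcase with h | h
    · rw [dyadicPart_eq_zero_of_ge, zero_mul]
      have : (2 : ℝ) ^ (k + 1) ≤ 2 ^ n := zpow_le_zpow_right₀ one_le_two h
      rw [zpow_add_one₀ two_ne_zero] at this
      linarith [hy.1]
    · rw [dyadicPart_eq_zero_of_le, zero_mul]
      have : (2 : ℝ) ^ (n + (M : ℤ) + 1) ≤ 2 ^ k := zpow_le_zpow_right₀ one_le_two h
      rw [zpow_add_one₀ two_ne_zero] at this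
      linarith [hupper y hy]
  rw [tsum_eq_sum hout, Finset.sum_map]
  simp only [truncatedPart]
  rw [← integral_finsetSum _ fun j _ =>
    ((hK _).integrable (hg.aestronglyMeasurable hα0) fun y _ => hg.bound y).integrableOn]
  refine setIntegral_congr_fun hmeas fun y hy => ?_
  simp only [dyadicPart]
  rw [← Finset.sum_mul, ← Finset.mul_sum]
  have := sum_annularCutoff_eq_one n M (hn.trans hy.1.le) (hupper y hy)
  simp only [he]
  rw [this, mul_one]

/-- Once the truncations clear the annulus at scale `2^k` they have no effect on this scale. -/
lemma eventually_truncatedPart_eq (x : Plane) (k : ℤ) :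
    ∀ᶠ p in 𝓝[>] (0 : ℝ) ×ˢ atTop,
      truncatedPart P g x p k = conv (dyadicPart P k) g x := by
  have h1 : ∀ᶠ ε in 𝓝[>] (0 : ℝ), 2 * ε < 2 ^ k := by
    have := Ioo_mem_nhdsGT (by positivity : (0 : ℝ) < 2 ^ k / 2)
    filter_upwards [this] with ε hε
    linarith [hε.2]
  have h2 := eventually_ge_atTop (‖x‖ + 2 * (2 : ℝ) ^ k)
  filter_upwards [h1.prod_mk h2] with p hp
  refine setIntegral_eq_integral_of_forall_compl_eq_zero fun y hy => ?_
  rw [Set.mem_ofPred_eq, not_and_or, not_lt, not_le] at hy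
  rcases hy with hy | hy
  · rw [dyadicPart_eq_zero_of_le P (by linarith [hp.1]), zero_mul]
  · rw [dyadicPart_eq_zero_of_ge, zero_mul]
    have := norm_sub_norm_le y x
    rw [norm_sub_rev] at this
    linarith [hp.2]

/-- The double truncation does not destroy the bounds for the single scales: below `|x|` the outer
truncation is invisible and the inner one preserves the mean value zero, above `|x|` the inner one
is invisible and the outer one preserves the symmetry. -/
lemma abs_truncatedPart_le (hα0 : 0 < α) (hα1 : α ≤ 1) (hm : 0 < m) (hg : RingBound α N g)
    (hgs : IsFoldSymmetric m g) (hK : ∀ k : ℤ, IsPiece m A (2 ^ k) (dyadicPart P k))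
    {x : Plane} (hx : x ≠ 0) {p : ℝ × ℝ} (hp1 : 2 * p.1 < ‖x‖)
    (hp2 : 5 * ‖x‖ ≤ p.2) (k : ℤ) :
    |truncatedPart P g x p k| ≤ 128 * π * A * N * dyadicWeight α 1 ‖x‖ k := by
  have hA := (hK k).const_nonneg (by positivity)
  have hN := hg.nonneg
  have h2k : (0 : ℝ) < 2 ^ k := by positivity
  have hx0 : 0 < ‖x‖ := norm_pos_iff.2 hx
  have hmeas := measurableSet_truncation x p.1 p.2
  rcases le_or_gt ((2 : ℝ) ^ k) ‖x‖ with hk | hk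
  · set K : Plane → ℝ := {z | p.1 < ‖z‖}.indicator (dyadicPart P k) with hKdef
    have hset : MeasurableSet {z : Plane | p.1 < ‖z‖} :=
      measurableSet_lt measurable_const measurable_norm
    have hKeq : truncatedPart P g x p k = conv K g x := by
      rw [truncatedPart, conv, ← integral_indicator hmeas]
      refine integral_congr_ae (Eventually.of_forall fun y => ?_)
      by_cases h1 : p.1 < ‖x - y‖
      · by_cases h2 : ‖y‖ ≤ p.2
        · simp [hKdef, h1, h2]
        · have h3 : dyadicPart P k (x - y) = 0 := by
            refine dyadicPart_eq_zero_of_ge P ?_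
            have := norm_sub_norm_le y x
            rw [norm_sub_rev] at this
            linarith
          simp [hKdef, h2, h3]
      · simp [hKdef, h1]
    have hKb : ∀ z, |K z| ≤ |dyadicPart P k z| := fun z => by
      simpa using norm_indicator_le_norm_self (s := {z | p.1 < ‖z‖}) (dyadicPart P k) z
    have hKi : Integrable K := (hK k).integrable_self.indicator hset
    have hKsym : ∀ z, ∑ i ∈ Finset.Icc 1 m, K (rot (2 * π * i / m) z) = 0 := fun z => by
      by_cases hz : p.1 < ‖z‖
      · simp only [hKdef, Set.indicator, Set.mem_ofPred_eq, norm_rot, hz, if_true, (hK k).symm]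
      · simp [hKdef, norm_rot, hz]
    rw [hKeq]
    refine (abs_conv_le_of_mean_zero hα0 hα1 hg h2k ((hK k).continuous.measurable.indicator hset)
      (fun z => (hKb z).trans ((hK k).bound z)) (fun z hz => ?_) hKi
      (integral_eq_zero_of_symmetrization hm hKsym hKi) hx).trans ?_
    · have := hKb z
      rwa [(hK k).supp z hz, abs_zero, abs_nonpos_iff] at this
    · refine mul_le_mul_of_nonneg_left (le_min le_rfl ?_) (by positivity)
      exact rpow_le_rpow_of_exponent_ge (by positivity) ((div_le_one hx0).2 hk) (by linarith)
  · set gR : Plane → ℝ := {y | ‖y‖ ≤ p.2}.indicator g with hgR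
    have hset : MeasurableSet {z : Plane | ‖z‖ ≤ p.2} :=
      measurableSet_le measurable_norm measurable_const
    have heq : truncatedPart P g x p k = conv (dyadicPart P k) gR x := by
      rw [truncatedPart, conv, ← integral_indicator hmeas]
      refine integral_congr_ae (Eventually.of_forall fun y => ?_)
      by_cases h2 : ‖y‖ ≤ p.2
      · by_cases h1 : p.1 < ‖x - y‖
        · simp [hgR, h1, h2]
        · have h3 : dyadicPart P k (x - y) = 0 :=
            dyadicPart_eq_zero_of_le P (by linarith)
          simp [h1, h3]
      · simp [hgR, h2]
    have hb : ∀ y, |gR y| ≤ N := fun y => by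
      have := norm_indicator_le_norm_self (s := {y | ‖y‖ ≤ p.2}) g y
      exact this.trans (hg.bound y)
    have hs : IsFoldSymmetric m gR := fun y => by
      simp only [hgR, Set.indicator, Set.mem_ofPred_eq, norm_rot, hgs y]
    rw [heq]
    refine (abs_conv_piece_le' hm ((hg.aestronglyMeasurable hα0).indicator hset) hb hs hK k
      x).trans ?_
    have h1 : ‖x‖ / (2 : ℝ) ^ k = ((2 : ℝ) ^ k / ‖x‖) ^ (-1 : ℝ) := by rw [rpow_neg_one, inv_div]
    have h2 : ‖x‖ / (2 : ℝ) ^ k ≤ dyadicWeight α 1 ‖x‖ k := by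
      refine le_min ?_ h1.le
      calc ‖x‖ / (2 : ℝ) ^ k ≤ 1 := (div_le_one h2k).2 hk.le
        _ ≤ _ := one_le_rpow ((one_le_div hx0).2 hk.le) hα0.le
    have h3 : 0 ≤ ‖x‖ / (2 : ℝ) ^ k := by positivity
    gcongr
    norm_num

lemma truncatedPart_zero (hα0 : 0 < α) (hm : 0 < m) (hg : RingBound α N g)
    (hgs : IsFoldSymmetric m g) (hK : ∀ k : ℤ, IsPiece m A (2 ^ k) (dyadicPart P k))
    (p : ℝ × ℝ) (k : ℤ) : truncatedPart P g 0 p k = 0 := by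
  set gR : Plane → ℝ := {y | p.1 < ‖y‖ ∧ ‖y‖ ≤ p.2}.indicator g with hgR
  have hset : MeasurableSet {y : Plane | p.1 < ‖y‖ ∧ ‖y‖ ≤ p.2} := by
    simpa using measurableSet_truncation 0 p.1 p.2
  have hb : ∀ y, |gR y| ≤ N := fun y => by
    have := norm_indicator_le_norm_self (s := {y | p.1 < ‖y‖ ∧ ‖y‖ ≤ p.2}) g y
    exact this.trans (hg.bound y)
  have hs : IsFoldSymmetric m gR := fun y => by
    by_cases h : p.1 < ‖y‖ ∧ ‖y‖ ≤ p.2 <;> simp [hgR, norm_rot, h, hgs y]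
  rw [← (hK k).conv_zero hm hs ((hg.aestronglyMeasurable hα0).indicator hset) fun y _ => hb y,
    truncatedPart, conv, ← integral_indicator (measurableSet_truncation 0 p.1 p.2)]
  refine integral_congr_ae (Eventually.of_forall fun y => ?_)
  by_cases h : p.1 < ‖y‖ ∧ ‖y‖ ≤ p.2 <;> simp [hgR, h]

lemma hasPrincipalValue_tsum (hα0 : 0 < α) (hα1 : α ≤ 1) (hm : 0 < m) (hg : RingBound α N g)
    (hgs : IsFoldSymmetric m g) (hK : ∀ k : ℤ, IsPiece m A (2 ^ k) (dyadicPart P k)) (x : Plane) :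
    HasPrincipalValue P g x (∑' k, conv (dyadicPart P k) g x) := by
  have hpos : ∀ᶠ p in 𝓝[>] (0 : ℝ) ×ˢ (atTop : Filter ℝ), 0 < p.1 :=
    (eventually_mem_nhdsWithin (a := (0 : ℝ)) (s := Set.Ioi 0)).prod_inl _
  have hlim : Tendsto (fun p => ∑' k, truncatedPart P g x p k) (𝓝[>] (0 : ℝ) ×ˢ atTop)
      (𝓝 (∑' k, conv (dyadicPart P k) g x)) := by
    have hk : ∀ k, Tendsto (fun p => truncatedPart P g x p k) (𝓝[>] (0 : ℝ) ×ˢ atTop)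
        (𝓝 (conv (dyadicPart P k) g x)) := fun k =>
      tendsto_const_nhds.congr' ((eventually_truncatedPart_eq x k).mono fun p hp => hp.symm)
    rcases eq_or_ne x 0 with rfl | hx
    · refine tendsto_tsum_of_dominated_convergence (bound := fun _ => 0) summable_zero hk
        (Eventually.of_forall fun p k => ?_)
      rw [truncatedPart_zero hα0 hm hg hgs hK, norm_zero]
    · have hx0 : 0 < ‖x‖ := norm_pos_iff.2 hx
      obtain ⟨C, -, hC⟩ := exists_dyadicWeight_bound hα0 one_pos
      refine tendsto_tsum_of_dominated_convergence
        (bound := fun k => 128 * π * A * N * dyadicWeight α 1 ‖x‖ k)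
        ((hC _ hx0).1.mul_left _) hk ?_
      have h1 : ∀ᶠ ε in 𝓝[>] (0 : ℝ), 2 * ε < ‖x‖ := by
        filter_upwards [Ioo_mem_nhdsGT (by positivity : (0 : ℝ) < ‖x‖ / 2)] with ε hε
        linarith [hε.2]
      filter_upwards [h1.prod_mk (eventually_ge_atTop (5 * ‖x‖))] with p hp k
      exact abs_truncatedPart_le hα0 hα1 hm hg hgs hK hx hp.1 hp.2 k
  refine hlim.congr' ?_
  filter_upwards [hpos] with p hp
  exact tsum_truncatedPart hα0 hg hK x hp

end PrincipalValue

/-- Singular integrals with vanishing `m`-fold symmetrization act boundedly on the `m`-fold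
symmetric functions of the critical space, uniformly in `m`. -/
theorem exists_singularIntegral_bound {α : ℝ} (hα0 : 0 < α) (hα1 : α < 1) (P : Plane → ℝ)
    (hP : IsSingularKernel P) :
    ∃ C : ℝ≥0, ∀ m : ℕ, 3 ≤ m → HasIntegrableSymmetrization m P →
      ∀ g : Plane → ℝ, IsFoldSymmetric m g → MemRing α g →
        ∃ Tg : Plane → ℝ, (∀ x, HasPrincipalValue P g x (Tg x)) ∧
          MemRing α Tg ∧ ringNorm α Tg ≤ C * ringNorm α g := by
  obtain ⟨A, hA⟩ := hP.exists_isPiece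
  obtain ⟨C, hC, h⟩ := exists_superposition_bound hα0 hα1
  refine ⟨(2 * (C * |A|)).toNNReal, fun m hm hsym g hgs hg => ?_⟩
  have hK := hA m hsym
  have hA0 := (hK 0).const_nonneg (by positivity)
  obtain ⟨-, -, hT⟩ := h m A _ _ g (by omega) hg.ringBound hgs hK
  refine ⟨fun x => ∑' k, conv (dyadicPart P k) g x,
    hasPrincipalValue_tsum hα0 hα1.le (by omega) hg.ringBound hgs hK, ?_⟩
  rw [abs_of_nonneg hA0]
  exact hT.memRing_and_le (by positivity) hg

/-! ### Partial derivatives -/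

lemma fderiv_apply_eq_sum (g : Plane → ℝ) (x v : Plane) :
    fderiv ℝ g x v = v 0 * partialDeriv 0 g x + v 1 * partialDeriv 1 g x := by
  have hv : v = v 0 • EuclideanSpace.single 0 1 + v 1 • EuclideanSpace.single 1 1 := by
    apply plane_ext <;> simp
  conv_lhs => rw [hv, map_add, map_smul, map_smul]
  simp [partialDeriv]

lemma abs_apply_le_norm (v : Plane) (i : Fin 2) : |v i| ≤ ‖v‖ := by
  simpa using PiLp.norm_apply_le v i

lemma norm_fderiv_le_of_partialDeriv {g : Plane → ℝ} {x : Plane} {M : ℝ}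
    (h : ∀ i, |partialDeriv i g x| ≤ M) : ‖fderiv ℝ g x‖ ≤ 2 * M := by
  have hM : 0 ≤ M := (abs_nonneg _).trans (h 0)
  refine ContinuousLinearMap.opNorm_le_bound _ (by positivity) fun v => ?_
  rw [fderiv_apply_eq_sum, Real.norm_eq_abs]
  refine (abs_add_le _ _).trans ?_
  rw [abs_mul, abs_mul]
  have h0 := mul_le_mul (abs_apply_le_norm v 0) (h 0) (abs_nonneg _) (norm_nonneg v)
  have h1 := mul_le_mul (abs_apply_le_norm v 1) (h 1) (abs_nonneg _) (norm_nonneg v)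
  linarith

lemma ContDiff.partialDeriv {g : Plane → ℝ} (hg : ContDiff ℝ ∞ g) (i : Fin 2) :
    ContDiff ℝ ∞ (partialDeriv i g) :=
  (hg.fderiv_right (m := ∞) (by norm_cast)).clm_apply contDiff_const

lemma ContDiff.differentiable_top {g : Plane → ℝ} (hg : ContDiff ℝ ∞ g) : Differentiable ℝ g :=
  hg.differentiable (by simp)

lemma HasCompactSupport.partialDeriv {g : Plane → ℝ} (hg : HasCompactSupport g) (i : Fin 2) :
    HasCompactSupport (partialDeriv i g) :=
  hg.fderiv_apply (𝕜 := ℝ) _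

lemma abs_sub_le_of_partialDeriv {g : Plane → ℝ} (hg : Differentiable ℝ g) {r M : ℝ}
    (h : ∀ y, ‖y‖ ≤ r → ∀ i, |partialDeriv i g y| ≤ M) {x y : Plane} (hx : ‖x‖ ≤ r)
    (hy : ‖y‖ ≤ r) : |g x - g y| ≤ 2 * M * ‖x - y‖ := by
  have := (convex_closedBall (0 : Plane) r).norm_image_sub_le_of_norm_fderiv_le (𝕜 := ℝ) (f := g)
    (C := 2 * M) (fun z _ => hg z) (fun z hz => norm_fderiv_le_of_partialDeriv
      (h z (by simpa using hz))) (by simpa using hy) (by simpa using hx)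
  simpa using this

lemma laplacian_eq_sum_partialDeriv {φ : Plane → ℝ} (hφ : ContDiff ℝ ∞ φ) (x : Plane) :
    (Δ φ) x = ∑ i, partialDeriv i (partialDeriv i φ) x := by
  rw [InnerProductSpace.laplacian_eq_iteratedFDeriv_orthonormalBasis φ
    (EuclideanSpace.basisFun (Fin 2) ℝ)]
  refine Finset.sum_congr rfl fun i _ => ?_
  rw [iteratedFDeriv_two_apply]
  have hd : DifferentiableAt ℝ (fderiv ℝ φ) x :=
    (hφ.fderiv_right (m := ∞) (by norm_cast)).differentiable (by simp) x
  have h := fderiv_clm_apply hd (differentiableAt_const (EuclideanSpace.single i (1 : ℝ)))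
  simp only [partialDeriv] at h ⊢
  change _ = fderiv ℝ (fun y => fderiv ℝ φ y (EuclideanSpace.single i 1)) x _
  rw [h]
  simp

/-- Integration by parts twice. -/
lemma integral_mul_partialDeriv_partialDeriv {g φ : Plane → ℝ} (hg : ContDiff ℝ ∞ g)
    (hφ : ContDiff ℝ ∞ φ) (hc : HasCompactSupport φ) (i j : Fin 2) :
    ∫ x, g x * partialDeriv i (partialDeriv j φ) x =
      ∫ x, partialDeriv j (partialDeriv i g) x * φ x := by
  have hparts : ∀ (u v : Plane → ℝ) (k : Fin 2), ContDiff ℝ ∞ u → ContDiff ℝ ∞ v →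
      HasCompactSupport v → ∫ x, u x * partialDeriv k v x = -∫ x, partialDeriv k u x * v x := by
    intro u v k hu hv hvc
    refine integral_mul_fderiv_eq_neg_fderiv_mul_of_integrable ?_ ?_ ?_
      (fun x _ => hu.differentiable_top x) fun x _ => hv.differentiable_top x
    · exact ((hu.partialDeriv k).continuous.mul hv.continuous).integrable_of_hasCompactSupport
        hvc.mul_left
    · exact (hu.continuous.mul (hv.partialDeriv k).continuous).integrable_of_hasCompactSupport
        (hvc.partialDeriv k).mul_left
    · exact (hu.continuous.mul hv.continuous).integrable_of_hasCompactSupport hvc.mul_left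
  rw [hparts g _ i hg (hφ.partialDeriv j) (hc.partialDeriv j),
    hparts _ φ j (hg.partialDeriv i) hφ hc, neg_neg]

/-! ### Limits of functions whose derivatives converge -/

/-- If the first derivatives converge pointwise away from the origin, boundedly on segments, then
so do the functions normalized by the value `0` at the origin. -/
lemma exists_tendsto_of_partialDeriv {g : ℕ → Plane → ℝ} {h : Fin 2 → Plane → ℝ} {B : Plane → ℝ}
    (hg : ∀ n, ContDiff ℝ ∞ (g n)) (h0 : ∀ n, g n 0 = 0)
    (hlim : ∀ i x, x ≠ 0 → Tendsto (fun n => partialDeriv i (g n) x) atTop (𝓝 (h i x)))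
    (hB : ∀ n i x y, ‖y‖ ≤ ‖x‖ → |partialDeriv i (g n) y| ≤ B x) (x : Plane) :
    ∃ l, Tendsto (fun n => g n x) atTop (𝓝 l) := by
  rcases eq_or_ne x 0 with rfl | hx
  · exact ⟨0, by simp [h0]⟩
  have hcont : ∀ n i, Continuous fun t : ℝ => partialDeriv i (g n) (t • x) := fun n i =>
    ((hg n).partialDeriv i).continuous.comp (continuous_id.smul continuous_const)
  have hint : ∀ n, g n x = ∫ t in (0 : ℝ)..1,
      (x 0 * partialDeriv 0 (g n) (t • x) + x 1 * partialDeriv 1 (g n) (t • x)) := by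
    intro n
    have hd : ∀ t : ℝ, HasDerivAt (fun t : ℝ => g n (t • x))
        (x 0 * partialDeriv 0 (g n) (t • x) + x 1 * partialDeriv 1 (g n) (t • x)) t := by
      intro t
      have h1 : HasDerivAt (fun t : ℝ => t • x) x t := by
        simpa using (hasDerivAt_id t).smul_const x
      have := ((hg n).differentiable_top (t • x)).hasFDerivAt.comp_hasDerivAt t h1
      rwa [fderiv_apply_eq_sum] at this
    have := intervalIntegral.integral_eq_sub_of_hasDerivAt (a := 0) (b := 1) (fun t _ => hd t)
      (Continuous.intervalIntegrable (by fun_prop (disch := exact hcont _ _)) _ _)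
    rw [this]
    simp [h0]
  simp only [hint]
  refine ⟨_, intervalIntegral.tendsto_integral_filter_of_dominated_convergence
    (F := fun n (t : ℝ) => x 0 * partialDeriv 0 (g n) (t • x) + x 1 * partialDeriv 1 (g n) (t • x))
    (f := fun t => x 0 * h 0 (t • x) + x 1 * h 1 (t • x))
    (fun _ => |x 0| * B x + |x 1| * B x) ?_ ?_ (by simp) ?_⟩
  · exact Eventually.of_forall fun n => Continuous.aestronglyMeasurable
      ((continuous_const.mul (hcont n 0)).add (continuous_const.mul (hcont n 1)))
  · refine Eventually.of_forall fun n => Eventually.of_forall fun t ht => ?_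
    rw [Set.uIoc_of_le zero_le_one] at ht
    have hle : ‖t • x‖ ≤ ‖x‖ := by
      rw [norm_smul_of_pos ht.1]
      exact mul_le_of_le_one_left (norm_nonneg x) ht.2
    rw [Real.norm_eq_abs]
    refine (abs_add_le _ _).trans ?_
    rw [abs_mul, abs_mul]
    exact add_le_add (mul_le_mul_of_nonneg_left (hB n 0 x _ hle) (abs_nonneg _))
      (mul_le_mul_of_nonneg_left (hB n 1 x _ hle) (abs_nonneg _))
  · refine Eventually.of_forall fun t ht => ?_
    rw [Set.uIoc_of_le zero_le_one] at ht
    have hne : t • x ≠ 0 := smul_ne_zero ht.1.ne' hx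
    exact ((hlim 0 _ hne).const_mul _).add ((hlim 1 _ hne).const_mul _)

/-- A differentiable `m`-fold symmetric function has a critical point at the origin. -/
lemma IsFoldSymmetric.partialDeriv_zero {m : ℕ} (hm : 3 ≤ m) {g : Plane → ℝ}
    (hg : IsFoldSymmetric m g) (hd : Differentiable ℝ g) (i : Fin 2) : partialDeriv i g 0 = 0 := by
  have h1 : ∀ (k : ℕ) (v : Plane), fderiv ℝ g 0 (rot (2 * π * k / m) v) = fderiv ℝ g 0 v := by
    intro k v
    have hcomp : g ∘ rotIso (2 * π * k / m) = g := funext fun x => hg.rot_mul k x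
    have h2 : HasFDerivAt (g ∘ rotIso (2 * π * k / m))
        ((fderiv ℝ g 0).comp
          ((rotIso (2 * π * k / m)).toContinuousLinearEquiv : Plane →L[ℝ] Plane)) 0 := by
      refine HasFDerivAt.comp 0 ?_ (rotIso (2 * π * k / m)).toContinuousLinearEquiv.hasFDerivAt
      simpa using! (hd 0).hasFDerivAt
    rw [hcomp] at h2
    conv_rhs => rw [h2.fderiv]
    rfl
  set v : Plane := EuclideanSpace.single i 1
  have hsum : ∑ k ∈ Finset.Icc 1 m, rot (2 * π * k / m) v = 0 := by
    apply plane_ext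
    · simpa using! sum_rot_apply_eq_zero hm v 0
    · simpa using! sum_rot_apply_eq_zero hm v 1
  have h3 : ∑ k ∈ Finset.Icc 1 m, fderiv ℝ g 0 (rot (2 * π * k / m) v) = 0 := by
    rw [← map_sum, hsum, map_zero]
  simp only [h1, Finset.sum_const, Nat.card_Icc, nsmul_eq_mul] at h3
  have : ((m + 1 - 1 : ℕ) : ℝ) ≠ 0 := by simp; omega
  exact (mul_eq_zero.1 h3).resolve_left this

/-! ### Derivatives of convolutions -/

lemma conv_eq_convolution (K f : Plane → ℝ) :
    conv K f = convolution f K (ContinuousLinearMap.mul ℝ ℝ) volume := by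
  funext x
  simp only [conv, convolution, ContinuousLinearMap.mul_apply', mul_comm]

section Conv

variable {K f : Plane → ℝ}

lemma contDiff_conv (hK : ContDiff ℝ ∞ K) (hc : HasCompactSupport K)
    (hf : LocallyIntegrable f volume) : ContDiff ℝ ∞ (conv K f) := by
  rw [conv_eq_convolution]
  exact hc.contDiff_convolution_right _ hf hK

lemma partialDeriv_conv (hK : ContDiff ℝ ∞ K) (hc : HasCompactSupport K)
    (hf : LocallyIntegrable f volume) (i : Fin 2) :
    partialDeriv i (conv K f) = conv (partialDeriv i K) f := by
  funext x
  have hK1 : ContDiff ℝ 1 K := hK.of_le (by exact_mod_cast le_top)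
  have h := hc.hasFDerivAt_convolution_right (ContinuousLinearMap.mul ℝ ℝ) hf hK1 x
  rw [partialDeriv, conv_eq_convolution, h.fderiv, convolution_precompR_apply _ hf
    (hc.fderiv (𝕜 := ℝ)) (hK1.continuous_fderiv (by simp)), conv_eq_convolution]
  rfl

lemma integrable_conv_of_continuous (hK : Continuous K) (hc : HasCompactSupport K)
    (hf : LocallyIntegrable f volume) (x : Plane) : Integrable fun y => K (x - y) * f y := by
  have h := hc.convolutionExists_right (ContinuousLinearMap.mul ℝ ℝ) hf hK x
  simpa [ConvolutionExistsAt, mul_comm] using h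

end Conv

/-! ### Hessians of radial functions -/

/-- The radial function `z ↦ e(|z|²)`. -/
noncomputable def radial (e : ℝ → ℝ) (z : Plane) : ℝ := e (‖z‖ ^ 2)

/-- Half the Kronecker symbol: the identity matrix divided by its trace. -/
noncomputable def halfDelta (i j : Fin 2) : ℝ := if i = j then 1 / 2 else 0

/-- The trace-free part of the Hessian of `radial e`. -/
noncomputable def traceFree (e : ℝ → ℝ) (i j : Fin 2) (z : Plane) : ℝ :=
  4 * deriv (deriv e) (‖z‖ ^ 2) * (z i * z j - halfDelta i j * ‖z‖ ^ 2)

/-- The Laplacian of `radial e`. -/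
noncomputable def radialLaplacian (e : ℝ → ℝ) (z : Plane) : ℝ :=
  4 * (deriv (deriv e) (‖z‖ ^ 2) * ‖z‖ ^ 2 + deriv e (‖z‖ ^ 2))

lemma radial_rot (e : ℝ → ℝ) (θ : ℝ) (z : Plane) : radial e (rot θ z) = radial e z := by
  rw [radial, radial, norm_rot]

lemma radial_neg (e : ℝ → ℝ) (z : Plane) : radial e (-z) = radial e z := by
  rw [radial, radial, norm_neg]

lemma radialLaplacian_neg (e : ℝ → ℝ) (z : Plane) :
    radialLaplacian e (-z) = radialLaplacian e z := by
  rw [radialLaplacian, radialLaplacian, norm_neg]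

lemma traceFree_comm (e : ℝ → ℝ) (i j : Fin 2) (z : Plane) :
    traceFree e i j z = traceFree e j i z := by
  simp only [traceFree, halfDelta, eq_comm (a := i), mul_comm (z i)]

lemma sum_traceFree (e : ℝ → ℝ) (z : Plane) : ∑ i, traceFree e i i z = 0 := by
  simp only [Fin.sum_univ_two, traceFree, halfDelta, if_true]
  rw [plane_norm_sq]
  ring

lemma sum_traceFree_rot {m : ℕ} (hm : 3 ≤ m) (e : ℝ → ℝ) (i j : Fin 2) (z : Plane) :
    ∑ k ∈ Finset.Icc 1 m, traceFree e i j (rot (2 * π * k / m) z) = 0 := by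
  simp only [traceFree, norm_rot, halfDelta]
  rw [← Finset.mul_sum, sum_rot_traceFree_eq_zero hm, mul_zero]

section Radial

variable {e : ℝ → ℝ}

lemma contDiff_deriv (he : ContDiff ℝ ∞ e) : ContDiff ℝ ∞ (deriv e) :=
  (contDiff_infty_iff_deriv.1 he).2

lemma contDiff_radial (he : ContDiff ℝ ∞ e) : ContDiff ℝ ∞ (radial e) :=
  he.comp (contDiff_norm_sq ℝ)

lemma contDiff_traceFree (he : ContDiff ℝ ∞ e) (i j : Fin 2) : ContDiff ℝ ∞ (traceFree e i j) :=
  (contDiff_const.mul (contDiff_radial (contDiff_deriv (contDiff_deriv he)))).mul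
    (((contDiff_piLp_apply (p := 2)).mul (contDiff_piLp_apply (p := 2))).sub
      (contDiff_const.mul (contDiff_norm_sq ℝ)))

lemma contDiff_radialLaplacian (he : ContDiff ℝ ∞ e) : ContDiff ℝ ∞ (radialLaplacian e) :=
  contDiff_const.mul (((contDiff_radial (contDiff_deriv (contDiff_deriv he))).mul
    (contDiff_norm_sq ℝ)).add (contDiff_radial (contDiff_deriv he)))

lemma deriv_eq_zero_of_lt {r s : ℝ} (he : ∀ s, r < s → e s = 0) (hs : r < s) : deriv e s = 0 := by
  have : e =ᶠ[𝓝 s] fun _ => 0 := by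
    filter_upwards [lt_mem_nhds hs] with t ht using he t ht
  rw [this.deriv_eq, deriv_const]

lemma traceFree_eq_zero {r : ℝ} (he : ∀ s, r < s → e s = 0) (i j : Fin 2) {z : Plane}
    (hz : r < ‖z‖ ^ 2) : traceFree e i j z = 0 := by
  rw [traceFree, deriv_eq_zero_of_lt (fun s hs => deriv_eq_zero_of_lt he hs) hz]
  simp

lemma radialLaplacian_eq_zero {r : ℝ} (he : ∀ s, r < s → e s = 0) {z : Plane}
    (hz : r < ‖z‖ ^ 2) : radialLaplacian e z = 0 := by
  rw [radialLaplacian, deriv_eq_zero_of_lt (fun s hs => deriv_eq_zero_of_lt he hs) hz,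
    deriv_eq_zero_of_lt he hz]
  simp

lemma hasCompactSupport_of_norm_sq {φ : Plane → ℝ} {r : ℝ} (h : ∀ z, r < ‖z‖ ^ 2 → φ z = 0) :
    HasCompactSupport φ :=
  hasCompactSupport_of_norm (r := √(max r 0)) fun z hz => h z <| by
    have := (Real.sqrt_lt (le_max_right r 0) (norm_nonneg z)).1 hz
    exact (le_max_left r 0).trans_lt this

lemma hasFDerivAt_radial (he : ContDiff ℝ ∞ e) (z : Plane) :
    HasFDerivAt (radial e) (deriv e (‖z‖ ^ 2) • (2 • innerSL ℝ z)) z := by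
  have h1 := (he.differentiable (by simp) (‖z‖ ^ 2)).hasDerivAt
  exact h1.comp_hasFDerivAt z (hasStrictFDerivAt_norm_sq z).hasFDerivAt

lemma partialDeriv_radial (he : ContDiff ℝ ∞ e) (i : Fin 2) :
    partialDeriv i (radial e) = fun z => 2 * (z i * radial (deriv e) z) := by
  funext z
  rw [partialDeriv, (hasFDerivAt_radial he z).fderiv]
  simp [EuclideanSpace.inner_single_right, radial]
  ring

lemma partialDeriv_partialDeriv_radial (he : ContDiff ℝ ∞ e) (i j : Fin 2) :
    partialDeriv i (partialDeriv j (radial e)) =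
      fun z => traceFree e i j z + halfDelta i j * radialLaplacian e z := by
  funext z
  have hcoord : HasFDerivAt (fun z : Plane => z j) (EuclideanSpace.proj (𝕜 := ℝ) j) z :=
    (EuclideanSpace.proj (𝕜 := ℝ) j).hasFDerivAt
  have h := (hcoord.mul (hasFDerivAt_radial (contDiff_deriv he) z)).const_mul 2
  rw [partialDeriv_radial he, partialDeriv,
    (show HasFDerivAt (fun z : Plane => 2 * (z j * radial (deriv e) z)) _ z from h).fderiv]
  simp only [traceFree, radialLaplacian, halfDelta, radial]
  fin_cases i <;> fin_cases j <;>
    simp [EuclideanSpace.inner_single_right] <;> ring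

variable {r : ℝ} {f : Plane → ℝ}

/-- The Hessian of the convolution with a radial kernel, split into its trace-free part and its
trace. -/
lemma partialDeriv_partialDeriv_conv_radial (he : ContDiff ℝ ∞ e) (hr : ∀ s, r < s → e s = 0)
    (hf : LocallyIntegrable f volume) (i j : Fin 2) (x : Plane) :
    partialDeriv i (partialDeriv j (conv (radial e) f)) x =
      conv (traceFree e i j) f x + halfDelta i j * conv (radialLaplacian e) f x := by
  have hc : HasCompactSupport (radial e) := hasCompactSupport_of_norm_sq fun z hz => hr _ hz
  rw [partialDeriv_conv (contDiff_radial he) hc hf,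
    partialDeriv_conv ((contDiff_radial he).partialDeriv j) (hc.partialDeriv j) hf,
    partialDeriv_partialDeriv_radial he]
  have h1 := integrable_conv_of_continuous (contDiff_traceFree he i j).continuous
    (hasCompactSupport_of_norm_sq fun z hz => traceFree_eq_zero hr i j hz) hf x
  have h2 := integrable_conv_of_continuous (contDiff_radialLaplacian he).continuous
    (hasCompactSupport_of_norm_sq fun z hz => radialLaplacian_eq_zero hr hz) hf x
  simp only [conv, add_mul, mul_assoc]
  rw [integral_add h1 (h2.const_mul _), integral_const_mul]

lemma sum_halfDelta : ∑ i, halfDelta i i = 1 := by norm_num [halfDelta]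

lemma laplacian_radial (he : ContDiff ℝ ∞ e) (z : Plane) :
    (Δ (radial e)) z = radialLaplacian e z := by
  rw [laplacian_eq_sum_partialDeriv (contDiff_radial he)]
  simp only [partialDeriv_partialDeriv_radial he]
  rw [Finset.sum_add_distrib, ← Finset.sum_mul, sum_traceFree, sum_halfDelta]
  ring

lemma partialDeriv_comp_sub (g : Plane → ℝ) (a : Plane) (i : Fin 2) :
    partialDeriv i (fun y => g (y - a)) = fun y => partialDeriv i g (y - a) := by
  funext y
  rw [partialDeriv, fderiv_comp_sub]
  rfl

/-- Testing a weak Laplace equation with a translate of a radial function. -/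
lemma WeakNegLaplacianEq.conv_radialLaplacian {ψ : Plane → ℝ}
    (h : WeakNegLaplacianEq ψ f) (he : ContDiff ℝ ∞ e) (hr : ∀ s, r < s → e s = 0) (x : Plane) :
    conv (radialLaplacian e) ψ x = -conv (radial e) f x := by
  have hc : HasCompactSupport (radial e) := hasCompactSupport_of_norm_sq fun z hz => hr _ hz
  have hcd : ContDiff ℝ ∞ fun y => radial e (y - x) :=
    (contDiff_radial he).comp (contDiff_id.sub contDiff_const)
  have hlap : ∀ y, (Δ fun y => radial e (y - x)) y = radialLaplacian e (y - x) := fun y => by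
    rw [laplacian_eq_sum_partialDeriv hcd, ← laplacian_radial he,
      laplacian_eq_sum_partialDeriv (contDiff_radial he)]
    simp only [partialDeriv_comp_sub]
  have := h (fun y => radial e (y - x)) hcd
    (hc.comp_homeomorph (Homeomorph.subRight x))
  simp only [hlap, mul_neg, integral_neg] at this
  simp only [← neg_sub x, radial_neg, radialLaplacian_neg] at this
  simp only [conv, mul_comm _ (ψ _), mul_comm _ (f _)]
  rw [← this, neg_neg]

end Radial

/-! ### A smooth dyadic decomposition of the logarithm -/

/-- A smooth cutoff on the line, equal to `1` on `(-∞, 1]` and to `0` on `[4, ∞)`. -/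
noncomputable def lineCutoff (s : ℝ) : ℝ := smoothTransition ((4 - s) / 3)

lemma contDiff_lineCutoff : ContDiff ℝ ∞ lineCutoff :=
  smoothTransition.contDiff.comp ((contDiff_const.sub contDiff_id).div_const 3)

lemma lineCutoff_eq_one {s : ℝ} (hs : s ≤ 1) : lineCutoff s = 1 :=
  smoothTransition.one_of_one_le (by linarith)

lemma lineCutoff_eq_zero {s : ℝ} (hs : 4 ≤ s) : lineCutoff s = 0 :=
  smoothTransition.zero_of_nonpos (by linarith)

lemma antitone_lineCutoff : Antitone lineCutoff := fun a b hab =>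
  smoothTransition.monotone (by linarith)

/-- The derivative of `annularLog`. -/
noncomputable def annularSlope (s : ℝ) : ℝ := (lineCutoff (s / 4) - lineCutoff s) / s

lemma annularSlope_eq_zero_of_le {s : ℝ} (hs : s ≤ 1) : annularSlope s = 0 := by
  rw [annularSlope, lineCutoff_eq_one hs, lineCutoff_eq_one (by linarith), sub_self, zero_div]

lemma annularSlope_eq_zero_of_ge {s : ℝ} (hs : 16 ≤ s) : annularSlope s = 0 := by
  rw [annularSlope, lineCutoff_eq_zero (by linarith), lineCutoff_eq_zero (by linarith), sub_self,
    zero_div]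

lemma mul_annularSlope (s : ℝ) : s * annularSlope s = lineCutoff (s / 4) - lineCutoff s := by
  rcases eq_or_ne s 0 with rfl | hs
  · simp
  · rw [annularSlope]; field_simp

lemma contDiff_annularSlope : ContDiff ℝ ∞ annularSlope := by
  rw [contDiff_iff_contDiffAt]
  intro s
  rcases lt_or_ge s 1 with hs | hs
  · have : annularSlope =ᶠ[𝓝 s] fun _ => 0 := by
      filter_upwards [gt_mem_nhds hs] with t ht using annularSlope_eq_zero_of_le ht.le
    exact contDiffAt_const.congr_of_eventuallyEq this
  · have hc : ContDiff ℝ ∞ fun s => lineCutoff (s / 4) - lineCutoff s :=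
      (contDiff_lineCutoff.comp (contDiff_id.div_const 4)).sub contDiff_lineCutoff
    exact hc.contDiffAt.div contDiffAt_id (by simp; linarith)

/-- A smooth function vanishing on `[16, ∞)` such that the dilations `annularLog (|z|² / 4^k)` sum
up to a multiple of the logarithmic potential, up to constants. -/
noncomputable def annularLog (s : ℝ) : ℝ := ∫ t in (16 : ℝ)..s, annularSlope t

lemma hasDerivAt_annularLog (s : ℝ) : HasDerivAt annularLog (annularSlope s) s :=
  intervalIntegral.integral_hasDerivAt_right
    (contDiff_annularSlope.continuous.intervalIntegrable _ _)
    contDiff_annularSlope.continuous.stronglyMeasurable.stronglyMeasurableAtFilter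
    contDiff_annularSlope.continuous.continuousAt

lemma deriv_annularLog : deriv annularLog = annularSlope :=
  funext fun s => (hasDerivAt_annularLog s).deriv

lemma contDiff_annularLog : ContDiff ℝ ∞ annularLog := by
  rw [contDiff_infty_iff_deriv, deriv_annularLog]
  exact ⟨fun s => (hasDerivAt_annularLog s).differentiableAt, contDiff_annularSlope⟩

lemma annularLog_eq_zero {s : ℝ} (hs : 16 < s) : annularLog s = 0 := by
  rw [annularLog, intervalIntegral.integral_congr (g := fun _ => 0)]
  · simp
  · intro t ht
    rw [Set.uIcc_of_le hs.le] at ht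
    exact annularSlope_eq_zero_of_ge ht.1

/-- The profile of the smooth approximation of the Dirac mass, up to normalization. -/
noncomputable def bumpProfile (s : ℝ) : ℝ := -4 * deriv lineCutoff s

lemma contDiff_bumpProfile : ContDiff ℝ ∞ bumpProfile :=
  contDiff_const.mul (contDiff_deriv contDiff_lineCutoff)

lemma bumpProfile_nonneg (s : ℝ) : 0 ≤ bumpProfile s := by
  have := antitone_lineCutoff.deriv_nonpos (x := s)
  rw [bumpProfile]; linarith

lemma bumpProfile_eq_zero {s : ℝ} (hs : 4 < s) : bumpProfile s = 0 := by
  rw [bumpProfile, deriv_eq_zero_of_lt (r := 4) (fun s hs => lineCutoff_eq_zero hs.le) hs, mul_zero]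

lemma exists_bumpProfile_ne_zero : ∃ s : ℝ, 0 ≤ s ∧ bumpProfile s ≠ 0 := by
  by_contra! h
  have hd : ∀ s ∈ Set.Ico (0 : ℝ) 4, HasDerivWithinAt lineCutoff 0 (Set.Ici s) s := fun s hs => by
    have h1 := (contDiff_lineCutoff.differentiable (by simp) s).hasDerivAt
    have h2 := h s hs.1
    rw [bumpProfile] at h2
    have h3 : deriv lineCutoff s = 0 := by linarith
    rw [h3] at h1
    exact h1.hasDerivWithinAt
  have := constant_of_has_deriv_right_zero contDiff_lineCutoff.continuous.continuousOn hd 4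
    (by simp)
  rw [lineCutoff_eq_zero le_rfl, lineCutoff_eq_one zero_le_one] at this
  exact zero_ne_one this

lemma deriv_comp_div (e : ℝ → ℝ) (c : ℝ) :
    deriv (fun s => e (s / c)) = fun s => deriv e (s / c) / c := by
  funext s
  have := deriv_comp_mul_left c⁻¹ e s
  simpa [div_eq_inv_mul] using this

/-- The Laplacian of the annular piece of the logarithm is the difference of two approximations of
the Dirac mass at consecutive dyadic scales. -/
lemma radialLaplacian_annularLog (z : Plane) :
    radialLaplacian annularLog z =
      radial bumpProfile z - radial bumpProfile ((2 : ℝ)⁻¹ • z) / 4 := by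
  have h1 : deriv (fun s => s * annularSlope s) (‖z‖ ^ 2) =
      annularSlope (‖z‖ ^ 2) + ‖z‖ ^ 2 * deriv annularSlope (‖z‖ ^ 2) := by
    have := (hasDerivAt_id (‖z‖ ^ 2)).mul
      (contDiff_annularSlope.differentiable (by simp) (‖z‖ ^ 2)).hasDerivAt
    simpa using! this.deriv
  have h2 : deriv (fun s => s * annularSlope s) (‖z‖ ^ 2) =
      deriv lineCutoff (‖z‖ ^ 2 / 4) / 4 - deriv lineCutoff (‖z‖ ^ 2) := by
    have hd := contDiff_lineCutoff.differentiable (n := ∞) (by simp)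
    simp only [mul_annularSlope]
    rw [deriv_fun_sub (f := fun s => lineCutoff (s / 4))
      ((hd _).comp _ (differentiableAt_id.div_const 4)) (hd _)]
    congr 1
    exact congrFun (deriv_comp_div lineCutoff 4) _
  have h3 : ‖(2 : ℝ)⁻¹ • z‖ ^ 2 = ‖z‖ ^ 2 / 4 := by
    rw [norm_smul_of_pos (by norm_num)]; ring
  rw [radialLaplacian, deriv_annularLog, radial, radial, h3, bumpProfile, bumpProfile]
  linear_combination 4 * (h2 - h1)

/-! ### Dilations of radial kernels -/

/-- The profile of the dilation by `t` of a radial function. -/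
noncomputable def dilate (e : ℝ → ℝ) (t : ℝ) (s : ℝ) : ℝ := e (s / t ^ 2)

section Dilate

variable {e : ℝ → ℝ} {t : ℝ}

lemma norm_inv_smul_sq (ht : 0 < t) (z : Plane) : ‖t⁻¹ • z‖ ^ 2 = ‖z‖ ^ 2 / t ^ 2 := by
  rw [norm_smul_of_pos (by positivity)]; field_simp

lemma contDiff_dilate (he : ContDiff ℝ ∞ e) : ContDiff ℝ ∞ (dilate e t) :=
  he.comp (contDiff_id.div_const _)

lemma dilate_eq_zero {r : ℝ} (hr : ∀ s, r < s → e s = 0) (ht : 0 < t) :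
    ∀ s, r * t ^ 2 < s → dilate e t s = 0 := fun s hs =>
  hr _ (by rwa [lt_div_iff₀ (by positivity)])

lemma deriv_deriv_dilate : deriv (deriv (dilate e t)) =
    fun s => deriv (deriv e) (s / t ^ 2) / t ^ 2 / t ^ 2 := by
  have h : deriv (dilate e t) = fun s => deriv e (s / t ^ 2) / t ^ 2 := deriv_comp_div e _
  rw [h]
  funext s
  rw [deriv_div_const, congrFun (deriv_comp_div (deriv e) (t ^ 2)) s]

lemma traceFree_dilate (ht : 0 < t) (i j : Fin 2) :
    traceFree (dilate e t) i j = fun z => traceFree e i j (t⁻¹ • z) / t ^ 2 := by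
  funext z
  rw [traceFree, traceFree, deriv_deriv_dilate, norm_inv_smul_sq ht]
  simp only [PiLp.smul_apply, smul_eq_mul]
  field_simp

lemma radialLaplacian_dilate (ht : 0 < t) :
    radialLaplacian (dilate e t) = fun z => radialLaplacian e (t⁻¹ • z) / t ^ 2 := by
  funext z
  rw [radialLaplacian, radialLaplacian, deriv_deriv_dilate, norm_inv_smul_sq ht]
  have h : deriv (dilate e t) = fun s => deriv e (s / t ^ 2) / t ^ 2 := deriv_comp_div e _
  rw [h]
  field_simp

end Dilate

/-! ### Approximation of the Dirac mass -/

/-- The profile of the approximate Dirac mass at scale `t`. -/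
noncomputable def deltaProfile (t s : ℝ) : ℝ := dilate bumpProfile t s / t ^ 2

/-- The approximation at scale `t` of `bumpMass` times the Dirac mass. -/
noncomputable def approxDelta (t : ℝ) : Plane → ℝ := radial (deltaProfile t)

/-- The total mass of `approxDelta t`. -/
noncomputable def bumpMass : ℝ := ∫ z, radial bumpProfile z

lemma approxDelta_eq {t : ℝ} (ht : 0 < t) :
    approxDelta t = fun z => radial bumpProfile (t⁻¹ • z) / t ^ 2 := by
  funext z
  rw [approxDelta, radial, deltaProfile, dilate, radial, norm_inv_smul_sq ht]

lemma contDiff_deltaProfile (t : ℝ) : ContDiff ℝ ∞ (deltaProfile t) :=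
  (contDiff_dilate contDiff_bumpProfile).div_const _

lemma deltaProfile_eq_zero {t : ℝ} (ht : 0 < t) : ∀ s, 4 * t ^ 2 < s → deltaProfile t s = 0 :=
  fun s hs => by
    rw [deltaProfile, dilate_eq_zero (fun _ => bumpProfile_eq_zero) ht s hs, zero_div]

lemma continuous_approxDelta (t : ℝ) : Continuous (approxDelta t) :=
  (contDiff_radial (contDiff_deltaProfile t)).continuous

lemma hasCompactSupport_approxDelta {t : ℝ} (ht : 0 < t) : HasCompactSupport (approxDelta t) :=
  hasCompactSupport_of_norm_sq fun _ hz => deltaProfile_eq_zero ht _ hz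

/-- With `m = 0` the condition on the symmetrization is empty, so that only the bounds remain. -/
lemma exists_isPiece_approxDelta : ∃ B : ℝ, ∀ t : ℝ, 0 < t → IsPiece 0 B t (approxDelta t) := by
  obtain ⟨B, hB⟩ := exists_isPiece_dilation (φ := radial bumpProfile)
    ((contDiff_radial contDiff_bumpProfile).of_le (by exact_mod_cast le_top))
    fun z hz => bumpProfile_eq_zero (by nlinarith)
  refine ⟨B, fun t ht => ?_⟩
  rw [approxDelta_eq ht]
  exact hB 0 (fun z => by simp) t ht

lemma bumpMass_pos : 0 < bumpMass := by
  obtain ⟨s, hs0, hs⟩ := exists_bumpProfile_ne_zero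
  have hz : radial bumpProfile (EuclideanSpace.single 0 (√s)) ≠ 0 := by
    rw [radial, PiLp.norm_single, Real.norm_eq_abs, sq_abs, sq_sqrt hs0]
    exact hs
  exact (contDiff_radial contDiff_bumpProfile).continuous
    |>.integral_pos_of_hasCompactSupport_nonneg_nonzero
      (hasCompactSupport_of_norm_sq fun _ hz => bumpProfile_eq_zero hz)
      (fun z => bumpProfile_nonneg _) hz

lemma integral_approxDelta {t : ℝ} (ht : 0 < t) : ∫ z, approxDelta t z = bumpMass := by
  rw [approxDelta_eq ht, integral_div, Measure.integral_comp_inv_smul_of_nonneg _ _ ht.le,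
    finrank_euclideanSpace_fin, smul_eq_mul, bumpMass]
  field_simp

lemma tendsto_conv_approxDelta {f : Plane → ℝ} {x : Plane} (hf : LocallyIntegrable f volume)
    (hx : ContinuousAt f x) :
    Tendsto (fun t => conv (approxDelta t) f x) (𝓝[>] 0) (𝓝 (bumpMass * f x)) := by
  obtain ⟨B, hB⟩ := exists_isPiece_approxDelta
  have hB0 : 0 ≤ B := (hB 1 one_pos).const_nonneg one_pos
  rw [Metric.tendsto_nhds]
  intro ε hε
  obtain ⟨δ, hδ, hδf⟩ := Metric.continuousAt_iff.1 hx (ε / (16 * π * (B + 1)))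
    (by positivity)
  filter_upwards [Ioo_mem_nhdsGT (by positivity : 0 < δ / 4)] with t ht
  have hd : conv (approxDelta t) f x - bumpMass * f x =
      conv (approxDelta t) (fun y => f y - f x) x := by
    have h1 := integrable_conv_of_continuous (continuous_approxDelta t)
      (hasCompactSupport_approxDelta ht.1) hf x
    have h2 : Integrable fun y => approxDelta t (x - y) * f x :=
      (((continuous_approxDelta t).integrable_of_hasCompactSupport
        (hasCompactSupport_approxDelta ht.1)).comp_sub_left x).mul_const _
    simp only [conv, mul_sub]
    rw [integral_sub h1 h2, integral_mul_const, integral_sub_left_eq_self (approxDelta t) volume x,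
      integral_approxDelta ht.1]
  rw [Real.dist_eq, hd]
  refine (abs_conv_le (M := ε / (16 * π * (B + 1))) ht.1 (hB t ht.1).bound (hB t ht.1).supp
    fun y hy => ?_).trans_lt ?_
  · refine (hδf (x := y) ?_).le
    rw [dist_comm, dist_eq_norm]
    linarith [ht.2]
  · rw [show 16 * π * (B * (ε / (16 * π * (B + 1)))) = ε * (B / (B + 1)) by field_simp]
    exact mul_lt_of_lt_one_right hε ((div_lt_one (by positivity)).2 (by linarith))

/-- Consecutive dyadic approximations of the Dirac mass differ by the Laplacian of a test
function. -/
lemma radialLaplacian_dilate_annularLog {t : ℝ} (ht : 0 < t) (z : Plane) :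
    radialLaplacian (dilate annularLog t) z = approxDelta t z - approxDelta (2 * t) z := by
  rw [radialLaplacian_dilate ht, approxDelta_eq ht, approxDelta_eq (by positivity)]
  simp only [radialLaplacian_annularLog, smul_smul, mul_inv]
  field_simp
  ring

lemma conv_radialLaplacian_dilate_annularLog {t : ℝ} (ht : 0 < t) {f : Plane → ℝ}
    (hf : LocallyIntegrable f volume) (x : Plane) :
    conv (radialLaplacian (dilate annularLog t)) f x =
      conv (approxDelta t) f x - conv (approxDelta (2 * t)) f x := by
  have h1 := integrable_conv_of_continuous (continuous_approxDelta t)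
    (hasCompactSupport_approxDelta ht) hf x
  have h2 := integrable_conv_of_continuous (continuous_approxDelta (2 * t))
    (hasCompactSupport_approxDelta (by positivity)) hf x
  simp only [conv, radialLaplacian_dilate_annularLog ht, sub_mul]
  rw [integral_sub h1 h2]

/-! ### Uniqueness: a Liouville theorem -/

section Liouville

variable {w : Plane → ℝ}

/-- The mean value property of weakly harmonic functions. -/
lemma conv_approxDelta_eq_of_harmonic (hw : Continuous w)
    (h : WeakNegLaplacianEq w fun _ => 0) {t : ℝ} (ht : 0 < t) (x : Plane) :
    conv (approxDelta t) w x = bumpMass * w x := by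
  have hstep : ∀ s : ℝ, 0 < s → conv (approxDelta (2 * s)) w x = conv (approxDelta s) w x := by
    intro s hs
    have h1 := h.conv_radialLaplacian (contDiff_dilate (t := s) contDiff_annularLog)
      (dilate_eq_zero (fun _ => annularLog_eq_zero) hs) x
    rw [conv_radialLaplacian_dilate_annularLog hs hw.locallyIntegrable] at h1
    simp only [conv, mul_zero, integral_zero, neg_zero] at h1 ⊢
    linarith
  have hn : ∀ n : ℕ, conv (approxDelta (t / 2 ^ n)) w x = conv (approxDelta t) w x := by
    intro n
    induction n with
    | zero => simp
    | succ n ih =>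
      rw [← ih, ← hstep _ (by positivity)]
      congr 2
      rw [pow_succ]; field_simp
  have hlim : Tendsto (fun n : ℕ => t / 2 ^ n) atTop (𝓝[>] 0) := by
    refine tendsto_nhdsWithin_iff.2 ⟨?_, Eventually.of_forall fun n => ?_⟩
    · exact tendsto_const_nhds.div_atTop (tendsto_pow_atTop_atTop_of_one_lt one_lt_two)
    · exact Set.mem_Ioi.2 (by positivity)
  have h1 := (tendsto_conv_approxDelta (x := x) hw.locallyIntegrable hw.continuousAt).comp hlim
  simp only [Function.comp_def, hn] at h1
  exact tendsto_nhds_unique tendsto_const_nhds h1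

lemma traceFree_deltaProfile {t : ℝ} (ht : 0 < t) (i j : Fin 2) (z : Plane) :
    traceFree (deltaProfile t) i j z = traceFree bumpProfile i j (t⁻¹ • z) / t ^ 2 / t ^ 2 := by
  have h : deriv (deriv (deltaProfile t)) =
      fun s => deriv (deriv (dilate bumpProfile t)) s / t ^ 2 := by
    have h1 : deriv (deltaProfile t) = fun s => deriv (dilate bumpProfile t) s / t ^ 2 :=
      funext fun s => deriv_div_const _
    rw [h1]
    exact funext fun s => deriv_div_const _
  rw [← congrFun (traceFree_dilate ht i j) z, traceFree, traceFree, h]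
  ring

/-- A weakly harmonic function of quadratic growth with `m`-fold symmetry, `m ≥ 3`, that vanishes
at the origin is zero: its Hessian is the convolution of the function with the trace-free Hessian
of an approximate Dirac mass of arbitrarily large scale. -/
theorem eq_zero_of_harmonic {m : ℕ} (hm : 3 ≤ m) (hw : Continuous w) (hs : IsFoldSymmetric m w)
    {C : ℝ} (hC : ∀ x, |w x| ≤ C * ‖x‖ ^ 2) (h : WeakNegLaplacianEq w fun _ => 0) (x : Plane) :
    w x = 0 := by
  have hmass := bumpMass_pos
  have hC0 : 0 ≤ C := by
    have := (abs_nonneg _).trans (hC (EuclideanSpace.single 0 1))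
    simpa using this
  have hU : ∀ t : ℝ, 0 < t → (fun x => bumpMass * w x) = conv (radial (deltaProfile t)) w :=
    fun t ht => funext fun x => (conv_approxDelta_eq_of_harmonic hw h ht x).symm
  have hcd : ContDiff ℝ ∞ fun x => bumpMass * w x := by
    rw [hU 1 one_pos]
    exact contDiff_conv (contDiff_radial (contDiff_deltaProfile 1))
      (hasCompactSupport_approxDelta one_pos) hw.locallyIntegrable
  have hhess : ∀ i j x, partialDeriv i (partialDeriv j fun x => bumpMass * w x) x = 0 := by
    intro i j x
    obtain ⟨A, hA⟩ := exists_isPiece_dilation (φ := traceFree bumpProfile i j)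
      ((contDiff_traceFree contDiff_bumpProfile i j).of_le (by exact_mod_cast le_top))
      fun z hz => traceFree_eq_zero (r := 4) (fun _ => bumpProfile_eq_zero) i j (by nlinarith)
    have hpiece := hA m (sum_traceFree_rot hm _ i j)
    have hbound : ∀ t : ℝ, 0 < t → ‖x‖ ≤ t →
        |partialDeriv i (partialDeriv j fun x => bumpMass * w x) x| ≤
          800 * π * A * C * ‖x‖ / t := by
      intro t ht hxt
      have hK := hpiece t ht
      have hM : ∀ y : Plane, ‖y‖ ≤ 5 * t → |w y| ≤ C * (5 * t) ^ 2 := fun y hy =>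
        (hC y).trans (by gcongr)
      have h1 := hK.abs_conv_sub_le ht hw.aestronglyMeasurable (x := x) (x' := 0)
        (fun y hy => hM y (by
          have := norm_sub_norm_le y x
          rw [norm_sub_rev] at this
          linarith))
        (fun y hy => hM y (by simp at hy; linarith))
      rw [hK.conv_zero (by omega) hs hw.aestronglyMeasurable (fun y hy => hM y (by linarith)),
        sub_zero, sub_zero] at h1
      rw [hU t ht, partialDeriv_partialDeriv_conv_radial (contDiff_deltaProfile t)
        (deltaProfile_eq_zero ht) hw.locallyIntegrable,
        h.conv_radialLaplacian (contDiff_deltaProfile t) (deltaProfile_eq_zero ht)]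
      have h2 : conv (traceFree (deltaProfile t) i j) w x =
          conv (fun z => traceFree bumpProfile i j (t⁻¹ • z) / t ^ 2) w x / t ^ 2 := by
        simp only [conv, traceFree_deltaProfile ht, div_mul_eq_mul_div, integral_div]
      have h3 : conv (radial (deltaProfile t)) (fun _ => 0) x = 0 := by simp [conv]
      rw [h2, h3, neg_zero, mul_zero, add_zero, abs_div, abs_of_pos (by positivity : 0 < t ^ 2),
        div_le_iff₀ (by positivity)]
      refine h1.trans_eq ?_
      field_simp
      ring
    have hlim : Tendsto (fun t : ℝ => 800 * π * A * C * ‖x‖ / t) atTop (𝓝 0) :=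
      tendsto_const_nhds.div_atTop tendsto_id
    have h0 := ge_of_tendsto hlim (by
      filter_upwards [eventually_gt_atTop 0, eventually_ge_atTop ‖x‖] with t ht hxt
        using hbound t ht hxt)
    exact abs_nonpos_iff.1 h0
  have hconst : ∀ g : Plane → ℝ, ContDiff ℝ ∞ g → (∀ i x, partialDeriv i g x = 0) →
      ∀ x, g x = g 0 := fun g hg hg0 x =>
    is_const_of_fderiv_eq_zero (𝕜 := ℝ) hg.differentiable_top
      (fun y => ContinuousLinearMap.ext fun v => by simp [fderiv_apply_eq_sum, hg0]) x 0
  have hsym : IsFoldSymmetric m fun x => bumpMass * w x := fun x => by simp only [hs x]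
  have hgrad : ∀ j x, partialDeriv j (fun x => bumpMass * w x) x = 0 := fun j x => by
    rw [hconst _ (hcd.partialDeriv j) (fun i => hhess i j) x,
      hsym.partialDeriv_zero hm hcd.differentiable_top]
  have hfin := hconst _ hcd hgrad x
  have hw0 : w 0 = 0 := by simpa using hC 0
  simp only [hw0, mul_zero] at hfin
  exact (mul_eq_zero.1 hfin).resolve_left hmass.ne'

end Liouville

/-! ### Smooth approximations of the Newtonian potential -/

lemma RingBound.locallyIntegrable {α N : ℝ} {f : Plane → ℝ} (hf : RingBound α N f)
    (hα : 0 < α) : LocallyIntegrable f volume := by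
  refine (locallyIntegrable_const N).mono (hf.aestronglyMeasurable hα)
    (Eventually.of_forall fun x => ?_)
  rw [Real.norm_eq_abs, Real.norm_of_nonneg hf.nonneg]
  exact hf.bound x

lemma RingBound.continuousAt {α N : ℝ} {f : Plane → ℝ} (hf : RingBound α N f) (hα0 : 0 < α)
    (hα1 : α ≤ 1) {x : Plane} (hx : x ≠ 0) : ContinuousAt f x := by
  have hlim : Tendsto (fun y => 2 * N * (‖x - y‖ / ‖x‖) ^ α) (𝓝 x) (𝓝 0) := by
    have hc : Continuous fun y => 2 * N * (‖x - y‖ / ‖x‖) ^ α :=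
      continuous_const.mul (((continuous_const.sub continuous_id).norm.div_const _).rpow_const
        fun _ => Or.inr hα0.le)
    simpa [zero_rpow hα0.ne'] using hc.tendsto x
  refine tendsto_iff_dist_tendsto_zero.2 (squeeze_zero (fun _ => dist_nonneg) (fun y => ?_) hlim)
  rw [Real.dist_eq]
  exact hf.abs_sub_le hα0.le hα1 hx y

lemma IsFoldSymmetric.conv_radial {m : ℕ} {f : Plane → ℝ} (hf : IsFoldSymmetric m f)
    (e : ℝ → ℝ) : IsFoldSymmetric m (conv (radial e) f) := fun x => by
  rw [conv, conv, ← integral_comp_rot (2 * π / m)]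
  simp only [← rot_sub, radial_rot, hf _]

lemma partialDeriv_add {g h : Plane → ℝ} (hg : Differentiable ℝ g) (hh : Differentiable ℝ h)
    (i : Fin 2) : partialDeriv i (fun x => g x + h x) =
      fun x => partialDeriv i g x + partialDeriv i h x := by
  funext x
  simp only [partialDeriv]
  rw [fderiv_fun_add (hg x) (hh x)]
  rfl

lemma partialDeriv_sum {ι : Type*} {S : Finset ι} {g : ι → Plane → ℝ}
    (hg : ∀ k, Differentiable ℝ (g k)) (i : Fin 2) :
    partialDeriv i (fun x => ∑ k ∈ S, g k x) = fun x => ∑ k ∈ S, partialDeriv i (g k) x := by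
  funext x
  simp only [partialDeriv]
  rw [fderiv_fun_sum fun k _ => hg k x, sum_apply]

lemma partialDeriv_add_const (g : Plane → ℝ) (c : ℝ) (i : Fin 2) :
    partialDeriv i (fun x => g x + c) = partialDeriv i g := by
  funext x
  simp only [partialDeriv]
  rw [fderiv_add_const]

/-- The potential generated by the scales between `2^(-n)` and `2^n`. The quadratic correction
makes up for the missing large scales: the mean value of `f` at infinity need not exist, but it only
contributes a multiple of `|x|²` to the potential. -/
noncomputable def potential (f : Plane → ℝ) (n : ℕ) (x : Plane) : ℝ :=
  ∑ k ∈ Finset.Ico (-n : ℤ) n, conv (radial (dilate annularLog (2 ^ k))) f x +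
    radial (fun s => conv (approxDelta (2 ^ (n : ℤ))) f 0 / 4 * s) x +
      -∑ k ∈ Finset.Ico (-n : ℤ) n, conv (radial (dilate annularLog (2 ^ k))) f 0

/-- The part at scale `2^k` of the kernel of the trace-free second derivatives of the potential. -/
noncomputable def hessianPiece (i j : Fin 2) (k : ℤ) : Plane → ℝ :=
  traceFree (dilate annularLog (2 ^ k)) i j

lemma exists_isPiece_hessianPiece : ∃ A : ℝ, ∀ m : ℕ, 3 ≤ m → ∀ (i j : Fin 2) (k : ℤ),
    IsPiece m A (2 ^ k) (hessianPiece i j k) := by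
  have h : ∀ i j : Fin 2, ∃ A : ℝ, ∀ m : ℕ, 3 ≤ m → ∀ k : ℤ,
      IsPiece m A (2 ^ k) (hessianPiece i j k) := by
    intro i j
    obtain ⟨A, hA⟩ := exists_isPiece_dilation (φ := traceFree annularLog i j)
      ((contDiff_traceFree contDiff_annularLog i j).of_le (by exact_mod_cast le_top))
      fun z hz => traceFree_eq_zero (r := 16) (fun _ => annularLog_eq_zero) i j (by nlinarith)
    refine ⟨A, fun m hm k => ?_⟩
    rw [hessianPiece, traceFree_dilate (by positivity)]
    exact hA m (sum_traceFree_rot hm _ i j) _ (by positivity)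
  choose A hA using h
  refine ⟨∑ i, ∑ j, |A i j|, fun m hm i j k => ?_⟩
  have hle : A i j ≤ ∑ i, ∑ j, |A i j| :=
    (le_abs_self _).trans ((Finset.single_le_sum (f := fun j => |A i j|)
      (fun _ _ => abs_nonneg _) (Finset.mem_univ j)).trans
      (Finset.single_le_sum (f := fun i => ∑ j, |A i j|)
        (fun _ _ => Finset.sum_nonneg fun _ _ => abs_nonneg _) (Finset.mem_univ i)))
  have hp := hA i j m hm k
  exact ⟨fun z => (hp.bound z).trans (by gcongr), fun z z' => (hp.lip z z').trans (by gcongr),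
    hp.supp, hp.symm⟩

section Potential

variable {f : Plane → ℝ}

lemma contDiff_conv_annularLog (hf : LocallyIntegrable f volume) (k : ℤ) :
    ContDiff ℝ ∞ (conv (radial (dilate annularLog (2 ^ k))) f) :=
  contDiff_conv (contDiff_radial (contDiff_dilate contDiff_annularLog))
    (hasCompactSupport_of_norm_sq fun _ hz =>
      dilate_eq_zero (fun _ => annularLog_eq_zero) (by positivity) _ hz) hf

lemma contDiff_potential (hf : LocallyIntegrable f volume) (n : ℕ) :
    ContDiff ℝ ∞ (potential f n) :=
  ((ContDiff.sum fun k _ => contDiff_conv_annularLog hf k).add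
    (contDiff_radial (contDiff_const.mul contDiff_id))).add contDiff_const

lemma potential_zero (n : ℕ) : potential f n 0 = 0 := by
  simp [potential, radial]

lemma IsFoldSymmetric.potential {m : ℕ} (hf : IsFoldSymmetric m f) (n : ℕ) :
    IsFoldSymmetric m (potential f n) := fun x => by
  simp only [_root_.potential, radial_rot, hf.conv_radial _ x]

lemma partialDeriv_partialDeriv_potential (hf : LocallyIntegrable f volume) (n : ℕ) (i j : Fin 2)
    (x : Plane) :
    partialDeriv i (partialDeriv j (potential f n)) x =
      ∑ k ∈ Finset.Ico (-n : ℤ) n, conv (hessianPiece i j k) f x +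
        halfDelta i j * (conv (approxDelta (2 ^ (-n : ℤ))) f x -
          (conv (approxDelta (2 ^ (n : ℤ))) f x - conv (approxDelta (2 ^ (n : ℤ))) f 0)) := by
  set d := conv (approxDelta (2 ^ (n : ℤ))) f 0 with hd
  have hsm := contDiff_conv_annularLog hf
  have hq : ContDiff ℝ ∞ fun s : ℝ => d / 4 * s := contDiff_const.mul contDiff_id
  have hq1 : deriv (fun s : ℝ => d / 4 * s) = fun _ => d / 4 := funext fun s => by
    simp
  have hS : ContDiff ℝ ∞ fun x => ∑ k ∈ Finset.Ico (-n : ℤ) n,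
      conv (radial (dilate annularLog (2 ^ k))) f x := ContDiff.sum fun k _ => hsm k
  have h1 : partialDeriv j (potential f n) = fun x => ∑ k ∈ Finset.Ico (-n : ℤ) n,
      partialDeriv j (conv (radial (dilate annularLog (2 ^ k))) f) x +
        partialDeriv j (radial fun s => d / 4 * s) x := by
    unfold potential
    rw [partialDeriv_add_const, partialDeriv_add hS.differentiable_top
      (contDiff_radial hq).differentiable_top, partialDeriv_sum fun k => (hsm k).differentiable_top]
  have hS' : ContDiff ℝ ∞ fun x => ∑ k ∈ Finset.Ico (-n : ℤ) n,
      partialDeriv j (conv (radial (dilate annularLog (2 ^ k))) f) x :=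
    ContDiff.sum fun k _ => (hsm k).partialDeriv j
  rw [h1, partialDeriv_add hS'.differentiable_top
    ((contDiff_radial hq).partialDeriv j).differentiable_top,
    partialDeriv_sum fun k => ((hsm k).partialDeriv j).differentiable_top]
  simp only [partialDeriv_partialDeriv_radial hq]
  have h2 : ∀ k : ℤ, partialDeriv i (partialDeriv j
      (conv (radial (dilate annularLog (2 ^ k))) f)) x =
        conv (hessianPiece i j k) f x + halfDelta i j *
          (conv (approxDelta (2 ^ k)) f x - conv (approxDelta (2 ^ (k + 1))) f x) := by
    intro k
    rw [partialDeriv_partialDeriv_conv_radial (contDiff_dilate contDiff_annularLog)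
      (dilate_eq_zero (fun _ => annularLog_eq_zero) (by positivity)) hf,
      conv_radialLaplacian_dilate_annularLog (by positivity) hf, zpow_add_one₀ two_ne_zero,
      mul_comm (2 : ℝ) (2 ^ k)]
    rfl
  simp only [h2]
  have htel := Finset.sum_Ico_int_sub n fun k => conv (approxDelta (2 ^ k)) f x
  rw [Finset.sum_add_distrib, ← Finset.mul_sum, htel, traceFree, radialLaplacian, hq1, deriv_const]
  ring

end Potential

/-! ### Existence of the Newtonian potential -/

lemma abs_halfDelta_le (i j : Fin 2) : |halfDelta i j| ≤ 1 := by
  rw [halfDelta]; split_ifs <;> norm_num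

lemma tendsto_two_zpow_neg : Tendsto (fun n : ℕ => (2 : ℝ) ^ (-n : ℤ)) atTop (𝓝[>] 0) := by
  refine tendsto_nhdsWithin_iff.2 ⟨?_, Eventually.of_forall fun n => Set.mem_Ioi.2 (by positivity)⟩
  have := tendsto_pow_atTop_nhds_zero_of_lt_one (r := (2 : ℝ)⁻¹) (by norm_num) (by norm_num)
  refine this.congr fun n => ?_
  rw [zpow_neg, zpow_natCast, inv_pow]

lemma tendsto_const_div_two_zpow (c : ℝ) :
    Tendsto (fun n : ℕ => c / (2 : ℝ) ^ (n : ℤ)) atTop (𝓝 0) := by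
  simp only [zpow_natCast]
  exact tendsto_const_nhds.div_atTop (tendsto_pow_atTop_atTop_of_one_lt one_lt_two)

/-- The Hessian of the limit of the potentials. -/
noncomputable def limitHessian (f : Plane → ℝ) (i j : Fin 2) (x : Plane) : ℝ :=
  ∑' k, conv (hessianPiece i j k) f x + halfDelta i j * bumpMass * f x

lemma sum_limitHessian (f : Plane → ℝ) (x : Plane) :
    ∑ i, limitHessian f i i x = bumpMass * f x := by
  have h : ∀ k, hessianPiece 1 1 k = fun z => -hessianPiece 0 0 k z := fun k => funext fun z => by
    have := sum_traceFree (dilate annularLog (2 ^ k)) z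
    rw [Fin.sum_univ_two] at this
    exact eq_neg_of_add_eq_zero_right this
  simp only [limitHessian, Fin.sum_univ_two, h, conv, neg_mul, integral_neg, tsum_neg, halfDelta,
    if_true]
  ring

/-- The potentials of the truncated kernels have uniformly bounded Hessians which converge away from
the origin. -/
lemma exists_hessian_bound {α : ℝ} (hα0 : 0 < α) (hα1 : α < 1) :
    ∃ C : ℝ, 0 ≤ C ∧ ∀ (m : ℕ) (N : ℝ) (f : Plane → ℝ), 3 ≤ m → RingBound α N f →
      IsFoldSymmetric m f →
      (∀ i j, RingBound α (C * N) (limitHessian f i j)) ∧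
      (∀ n i j x, |partialDeriv i (partialDeriv j (potential f n)) x| ≤ C * N) ∧
      ∀ i j x, x ≠ 0 → Tendsto (fun n => partialDeriv i (partialDeriv j (potential f n)) x) atTop
        (𝓝 (limitHessian f i j x)) := by
  obtain ⟨A, hA⟩ := exists_isPiece_hessianPiece
  obtain ⟨B, hB⟩ := exists_isPiece_approxDelta
  obtain ⟨C₀, hC₀, hsup⟩ := exists_superposition_bound hα0 hα1
  have hB0 : 0 ≤ B := (hB 1 one_pos).const_nonneg one_pos
  have hA0 : 0 ≤ A := (hA 3 le_rfl 0 0 0).const_nonneg (by positivity)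
  have hmass := bumpMass_pos
  refine ⟨C₀ * A + bumpMass + 48 * π * B, by positivity, fun m N f hm hf hfs => ?_⟩
  have hN := hf.nonneg
  have hloc := hf.locallyIntegrable hα0
  have hT := fun i j => hsup m A N (hessianPiece i j) f (by omega) hf hfs (hA m hm i j)
  have hδ : ∀ t : ℝ, 0 < t → ∀ x, |conv (approxDelta t) f x| ≤ 16 * π * (B * N) := fun t ht x =>
    abs_conv_le ht (hB t ht).bound (hB t ht).supp fun y _ => hf.bound y
  refine ⟨fun i j => ?_, fun n i j x => ?_, fun i j x hx => ?_⟩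
  · have h := (hT i j).2.2.add (hf.const_mul (halfDelta i j * bumpMass))
    refine ⟨fun x => (h.bound x).trans ?_, fun x x' => (h.holder x x').trans ?_⟩
    all_goals
      have h1 : |halfDelta i j * bumpMass| ≤ bumpMass := by
        rw [abs_mul, abs_of_pos hmass]
        exact mul_le_of_le_one_left hmass.le (abs_halfDelta_le i j)
      have h2 : C₀ * A * N + |halfDelta i j * bumpMass| * N ≤
          (C₀ * A + bumpMass + 48 * π * B) * N := by
        have h3 := mul_le_mul_of_nonneg_right h1 hN
        have h4 : 0 ≤ 48 * π * B * N := by positivity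
        linarith
    · exact h2
    · gcongr
  · rw [partialDeriv_partialDeriv_potential hloc]
    have h1 : |∑ k ∈ Finset.Ico (-n : ℤ) n, conv (hessianPiece i j k) f x| ≤ C₀ * A * N :=
      (Finset.abs_sum_le_sum_abs _ _).trans (((hT i j).1 x).sum_le_tsum _
        (fun _ _ => abs_nonneg _) |>.trans ((hT i j).2.1 x))
    have h2 := hδ (2 ^ (-n : ℤ)) (by positivity) x
    have h3 := hδ (2 ^ (n : ℤ)) (by positivity) x
    have h4 := hδ (2 ^ (n : ℤ)) (by positivity) 0
    refine (abs_add_le _ _).trans ?_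
    have h5 : |conv (approxDelta (2 ^ (-n : ℤ))) f x - (conv (approxDelta (2 ^ (n : ℤ))) f x -
        conv (approxDelta (2 ^ (n : ℤ))) f 0)| ≤ 48 * π * B * N := by
      refine (abs_sub _ _).trans ((add_le_add_right (abs_sub _ _) _).trans ?_)
      linarith
    rw [abs_mul]
    have h6 := mul_le_mul (abs_halfDelta_le i j) h5 (abs_nonneg _) zero_le_one
    have h7 : 0 ≤ bumpMass * N := by positivity
    linarith
  · simp only [partialDeriv_partialDeriv_potential hloc]
    have h1 : Tendsto (fun n : ℕ => ∑ k ∈ Finset.Ico (-n : ℤ) n, conv (hessianPiece i j k) f x)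
        atTop (𝓝 (∑' k, conv (hessianPiece i j k) f x)) :=
      ((hT i j).1 x).of_abs.hasSum.comp
        (Finset.tendsto_Ico_neg_atTop_atTop.comp tendsto_natCast_atTop_atTop)
    have h2 := (tendsto_conv_approxDelta hloc (hf.continuousAt hα0 hα1.le hx)).comp
      tendsto_two_zpow_neg
    have h3 : Tendsto (fun n : ℕ => conv (approxDelta (2 ^ (n : ℤ))) f x -
        conv (approxDelta (2 ^ (n : ℤ))) f 0) atTop (𝓝 0) := by
      refine squeeze_zero_norm (fun n => ?_)
        (tendsto_const_div_two_zpow (32 * π * (B * N) * ‖x‖))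
      have := (hB (2 ^ (n : ℤ)) (by positivity)).abs_conv_sub_le (by positivity)
        (hf.aestronglyMeasurable hα0) (x := x) (x' := 0) (fun y _ => hf.bound y)
        fun y _ => hf.bound y
      rw [sub_zero] at this
      exact this.trans_eq (by ring)
    have h4 := h1.add ((h2.sub h3).const_mul (halfDelta i j))
    simpa only [Function.comp_def, sub_zero, ← mul_assoc, limitHessian] using h4

/-- A symmetric solution of Poisson's equation, up to normalization, with its second derivatives. -/
lemma exists_limit_potential {α : ℝ} (hα0 : 0 < α) (hα1 : α < 1) :
    ∃ C : ℝ, 0 ≤ C ∧ ∀ (m : ℕ) (N : ℝ) (f : Plane → ℝ), 3 ≤ m → RingBound α N f →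
      IsFoldSymmetric m f → ∃ ψ : Plane → ℝ, Continuous ψ ∧ IsFoldSymmetric m ψ ∧
        (∃ D : ℝ, ∀ x, |ψ x| ≤ D * ‖x‖ ^ 2) ∧
        (∀ i j, WeakSecondDerivEq i j ψ (limitHessian f i j)) ∧
        ∀ i j, RingBound α (C * N) (limitHessian f i j) := by
  obtain ⟨C, hC, hH⟩ := exists_hessian_bound hα0 hα1
  refine ⟨C, hC, fun m N f hm hf hfs => ?_⟩
  obtain ⟨hG, hbd, hlim⟩ := hH m N f hm hf hfs
  have hN := hf.nonneg
  have hloc := hf.locallyIntegrable hα0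
  have hsm := contDiff_potential hloc
  have hgrad0 : ∀ n j, partialDeriv j (potential f n) 0 = 0 := fun n j =>
    (hfs.potential n).partialDeriv_zero hm (hsm n).differentiable_top j
  have hgrad : ∀ n j y, |partialDeriv j (potential f n) y| ≤ 2 * (C * N) * ‖y‖ := fun n j y => by
    have := abs_sub_le_of_partialDeriv ((hsm n).partialDeriv j).differentiable_top (r := ‖y‖)
      (fun z _ i => hbd n i j z) (x := y) (y := 0) le_rfl (by simp)
    rwa [hgrad0, sub_zero, sub_zero] at this
  have hlip : ∀ n x y, |potential f n x - potential f n y| ≤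
      4 * (C * N) * max ‖x‖ ‖y‖ * ‖x - y‖ := fun n x y => by
    refine (abs_sub_le_of_partialDeriv (hsm n).differentiable_top (r := max ‖x‖ ‖y‖)
      (M := 2 * (C * N) * max ‖x‖ ‖y‖) (fun z hz i => (hgrad n i z).trans ?_)
      (le_max_left _ _) (le_max_right _ _)).trans_eq (by ring)
    gcongr
  have hgrow : ∀ n x, |potential f n x| ≤ 4 * (C * N) * ‖x‖ ^ 2 := fun n x => by
    have := hlip n x 0
    rw [potential_zero, sub_zero, sub_zero, norm_zero, max_eq_left (norm_nonneg x)] at this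
    exact this.trans_eq (by ring)
  -- integrate the convergence of the Hessians twice along segments from the origin
  have hgradlim : ∀ j x, ∃ l, Tendsto (fun n => partialDeriv j (potential f n) x) atTop (𝓝 l) :=
    fun j => exists_tendsto_of_partialDeriv (B := fun _ => C * N)
      (fun n => (hsm n).partialDeriv j) (fun n => hgrad0 n j) (fun i x hx => hlim i j x hx)
      fun n i x y _ => hbd n i j y
  choose p hp using hgradlim
  have hψ : ∀ x, ∃ l, Tendsto (fun n => potential f n x) atTop (𝓝 l) :=
    exists_tendsto_of_partialDeriv (B := fun x => 2 * (C * N) * ‖x‖) hsm potential_zero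
      (fun j x _ => hp j x) fun n i x y hy => (hgrad n i y).trans (by gcongr)
  choose ψ hψ using hψ
  refine ⟨ψ, ?_, fun x => ?_, ⟨4 * (C * N), fun x => ?_⟩, fun i j φ hφ hc => ?_, hG⟩
  · rw [continuous_iff_continuousAt]
    intro x
    have hl : Tendsto (fun y => 4 * (C * N) * max ‖y‖ ‖x‖ * ‖y - x‖) (𝓝 x) (𝓝 0) := by
      have hc : Continuous fun y : Plane => 4 * (C * N) * max ‖y‖ ‖x‖ * ‖y - x‖ := by fun_prop
      simpa using hc.tendsto x
    refine tendsto_iff_dist_tendsto_zero.2 (squeeze_zero (fun _ => dist_nonneg) (fun y => ?_) hl)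
    rw [Real.dist_eq]
    exact le_of_tendsto' ((hψ y).sub (hψ x)).abs fun n => hlip n y x
  · exact tendsto_nhds_unique (hψ _) (by simpa only [hfs.potential _ x] using hψ x)
  · exact le_of_tendsto' (hψ x).abs fun n => hgrow n x
  · have hφ2 := (hφ.partialDeriv j).partialDeriv i
    have hc2 := (hc.partialDeriv j).partialDeriv i
    have hleft : Tendsto
        (fun n => ∫ x, potential f n x * partialDeriv i (partialDeriv j φ) x) atTop
        (𝓝 (∫ x, ψ x * partialDeriv i (partialDeriv j φ) x)) := by
      refine tendsto_integral_of_dominated_convergence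
        (fun x => 4 * (C * N) * ‖x‖ ^ 2 * |partialDeriv i (partialDeriv j φ) x|)
        (fun n => ((hsm n).continuous.mul hφ2.continuous).aestronglyMeasurable) ?_ (fun n => ?_) ?_
      · exact Continuous.integrable_of_hasCompactSupport
          ((continuous_const.mul (continuous_norm.pow 2)).mul hφ2.continuous.abs)
          (hc2.comp_left abs_zero).mul_left
      · refine Eventually.of_forall fun x => ?_
        rw [Real.norm_eq_abs, abs_mul]
        exact mul_le_mul_of_nonneg_right (hgrow n x) (abs_nonneg _)
      · exact Eventually.of_forall fun x => (hψ x).mul_const _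
    have hright : Tendsto
        (fun n => ∫ x, potential f n x * partialDeriv i (partialDeriv j φ) x) atTop
        (𝓝 (∫ x, limitHessian f i j x * φ x)) := by
      simp only [integral_mul_partialDeriv_partialDeriv (hsm _) hφ hc]
      refine tendsto_integral_of_dominated_convergence (fun x => C * N * |φ x|)
        (fun n => ((((hsm n).partialDeriv i).partialDeriv j).continuous.mul
          hφ.continuous).aestronglyMeasurable) ?_ (fun n => ?_) ?_
      · exact (continuous_const.mul hφ.continuous.abs).integrable_of_hasCompactSupport
          (hc.comp_left abs_zero).mul_left
      · refine Eventually.of_forall fun x => ?_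
        rw [Real.norm_eq_abs, abs_mul]
        exact mul_le_mul_of_nonneg_right (hbd n j i x) (abs_nonneg _)
      · have h0 : ∀ᵐ x : Plane, x ≠ 0 := by simp [ae_iff]
        filter_upwards [h0] with x hx
        have hsymm : limitHessian f i j x = limitHessian f j i x := by
          have : ∀ k, hessianPiece i j k = hessianPiece j i k := fun k =>
            funext fun z => traceFree_comm _ i j z
          simp only [limitHessian, this, halfDelta, eq_comm (a := i)]
        rw [hsymm]
        exact (hlim j i x hx).mul_const _
    exact tendsto_nhds_unique hleft hright

/-- A function whose weak second derivatives have trace `-f` solves `-Δψ = f` weakly. -/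
lemma weakNegLaplacianEq_of_weakSecondDerivEq {ψ f : Plane → ℝ} {G : Fin 2 → Fin 2 → Plane → ℝ}
    (hψ : Continuous ψ) (hG : ∀ i j, WeakSecondDerivEq i j ψ (G i j))
    (hint : ∀ i j, LocallyIntegrable (G i j) volume) (htr : ∀ x, ∑ i, G i i x = -f x) :
    WeakNegLaplacianEq ψ f := by
  intro φ hφ hc
  have h1 : ∀ i, Integrable fun x => ψ x * partialDeriv i (partialDeriv i φ) x := fun i =>
    (hψ.mul ((hφ.partialDeriv i).partialDeriv i).continuous).integrable_of_hasCompactSupport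
      ((hc.partialDeriv i).partialDeriv i).mul_left
  have h2 : ∀ i, Integrable fun x => G i i x * φ x := fun i => by
    simpa only [smul_eq_mul, mul_comm] using
      (hint i i).integrable_smul_left_of_hasCompactSupport hφ.continuous hc
  have h3 : ∀ x, f x = -∑ i, G i i x := fun x => by rw [htr, neg_neg]
  simp only [laplacian_eq_sum_partialDeriv hφ, mul_neg, Finset.mul_sum, h3, neg_mul,
    Finset.sum_mul, integral_neg]
  rw [integral_finsetSum _ fun i _ => h1 i, integral_finsetSum _ fun i _ => h2 i]
  simp only [hG _ _ φ hφ hc]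

/-- The difference of two inverses of the Laplacian is harmonic and hence zero. -/
lemma IsInverseNegLaplacian.unique {m : ℕ} (hm : 3 ≤ m) {f ψ ψ' : Plane → ℝ}
    (h : IsInverseNegLaplacian m f ψ) (h' : IsInverseNegLaplacian m f ψ') : ψ = ψ' := by
  obtain ⟨D, hD⟩ := h.growth
  obtain ⟨D', hD'⟩ := h'.growth
  funext x
  refine sub_eq_zero.1 (eq_zero_of_harmonic hm (w := fun x => ψ x - ψ' x)
    (h.continuous.sub h'.continuous) (fun x => by
      simp only [h.symmetric x, h'.symmetric x]) (C := D + D')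
    (fun x => ?_) (fun φ hφ hc => ?_) x)
  · refine (abs_sub _ _).trans ((add_le_add (hD x) (hD' x)).trans_eq (by ring))
  · have hcont : Continuous fun x => -(Δ φ) x := by
      simp only [laplacian_eq_sum_partialDeriv hφ]
      exact (continuous_finsetSum _ fun i _ => ((hφ.partialDeriv i).partialDeriv i).continuous).neg
    have hsupp : HasCompactSupport fun x => -(Δ φ) x := by
      simp only [laplacian_eq_sum_partialDeriv hφ, Fin.sum_univ_two]
      exact HasCompactSupport.neg (((hc.partialDeriv 0).partialDeriv 0).add
        ((hc.partialDeriv 1).partialDeriv 1))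
    simp only [sub_mul, zero_mul, integral_zero]
    have hi : Integrable fun x => ψ x * -(Δ φ) x :=
      (h.continuous.mul hcont).integrable_of_hasCompactSupport hsupp.mul_left
    have hi' : Integrable fun x => ψ' x * -(Δ φ) x :=
      (h'.continuous.mul hcont).integrable_of_hasCompactSupport hsupp.mul_left
    rw [integral_sub hi hi', h.equation φ hφ hc, h'.equation φ hφ hc, sub_self]

/-- The Newtonian potential of an `m`-fold symmetric function of the critical space, with the bound
for its second derivatives. -/
theorem exists_inverseNegLaplacian {α : ℝ} (hα0 : 0 < α) (hα1 : α < 1) :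
    ∃ C : ℝ≥0, ∀ m : ℕ, 3 ≤ m → ∀ f : Plane → ℝ, IsFoldSymmetric m f → MemRing α f →
      ∃ ψ : Plane → ℝ, IsInverseNegLaplacian m f ψ ∧
        ∃ G : Fin 2 → Fin 2 → Plane → ℝ, ∀ i j : Fin 2,
          WeakSecondDerivEq i j ψ (G i j) ∧ MemRing α (G i j) ∧
            ringNorm α (G i j) ≤ C * ringNorm α f := by
  obtain ⟨C, hC, h⟩ := exists_limit_potential hα0 hα1
  have hmass := bumpMass_pos
  refine ⟨(2 * (bumpMass⁻¹ * C)).toNNReal, fun m hm f hfs hf => ?_⟩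
  obtain ⟨ψ, hψc, hψs, ⟨D, hD⟩, hψw, hψr⟩ := h m _ f hm hf.ringBound hfs
  have hc : |(-bumpMass⁻¹)| = bumpMass⁻¹ := by rw [abs_neg, abs_of_pos (by positivity)]
  have hr : ∀ i j, RingBound α (bumpMass⁻¹ * C * (ringNorm α f).toReal)
      fun x => -bumpMass⁻¹ * limitHessian f i j x := fun i j => by
    have := (hψr i j).const_mul (-bumpMass⁻¹)
    rwa [hc, ← mul_assoc] at this
  have hw : ∀ i j, WeakSecondDerivEq i j (fun x => -bumpMass⁻¹ * ψ x)
      fun x => -bumpMass⁻¹ * limitHessian f i j x := fun i j φ hφ hcφ => by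
    simp only [mul_assoc, integral_const_mul]
    rw [hψw i j φ hφ hcφ]
  refine ⟨fun x => -bumpMass⁻¹ * ψ x, ⟨continuous_const.mul hψc, fun x => by rw [hψs x],
    ⟨bumpMass⁻¹ * D, fun x => ?_⟩, ?_⟩, _, fun i j => ⟨hw i j,
      (hr i j).memRing_and_le (by positivity) hf⟩⟩
  · rw [abs_mul, hc, mul_assoc]
    exact mul_le_mul_of_nonneg_left (hD x) (by positivity)
  · refine weakNegLaplacianEq_of_weakSecondDerivEq (continuous_const.mul hψc) hw
      (fun i j => (hr i j).locallyIntegrable hα0) fun x => ?_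
    rw [← Finset.mul_sum, sum_limitHessian]
    field_simp

theorem theoremB (α : ℝ) (hα0 : 0 < α) (hα1 : α < 1) :
    (∃ C : ℝ≥0, ∀ m : ℕ, 3 ≤ m → ∀ f : Plane → ℝ, IsFoldSymmetric m f → MemRing α f →
      (∃! ψ : Plane → ℝ, IsInverseNegLaplacian m f ψ) ∧
      ∀ ψ : Plane → ℝ, IsInverseNegLaplacian m f ψ →
        ∃ G : Fin 2 → Fin 2 → Plane → ℝ, ∀ i j : Fin 2,
          WeakSecondDerivEq i j ψ (G i j) ∧ MemRing α (G i j) ∧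
            ringNorm α (G i j) ≤ C * ringNorm α f) ∧
    (∀ P : Plane → ℝ, IsSingularKernel P →
      ∃ C : ℝ≥0, ∀ m : ℕ, 3 ≤ m → HasIntegrableSymmetrization m P →
        ∀ g : Plane → ℝ, IsFoldSymmetric m g → MemRing α g →
          ∃ Tg : Plane → ℝ, (∀ x, HasPrincipalValue P g x (Tg x)) ∧
            MemRing α Tg ∧ ringNorm α Tg ≤ C * ringNorm α g) := by
  refine ⟨?_, fun P hP => exists_singularIntegral_bound hα0 hα1 P hP⟩
  obtain ⟨C, hC⟩ := exists_inverseNegLaplacian hα0 hα1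
  refine ⟨C, fun m hm f hfs hf => ?_⟩
  obtain ⟨ψ, hψ, hG⟩ := hC m hm f hfs hf
  refine ⟨⟨ψ, hψ, fun ψ' h' => h'.unique hm hψ⟩, fun ψ' h' => ?_⟩
  rwa [h'.unique hm hψ]
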